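/- **Definitions.** Alphabets are finite. A context-free grammar $G=(V_N,\Sigma,P,S)$ (empty and renaming rules are allowed) is an *operator grammar* if no right part of a rule has two adjacent nonterminals. For a nonterminal $A$ let $\mathcal L_G(A)=\{a\in\Sigma\mid A\Rightarrow^* Ba\alpha\}$ and $\mathcal R_G(A)=\{a\in\Sigma\mid A\Rightarrow^*\alpha aB\}$, where $B\in V_N\cup\{\varepsilon\}$ and $\alpha\in(V_N\cup\Sigma)^*$. For $a,b\in\Sigma$ put: $a\doteq b$ if some rule is $A\to\alpha aBb\beta$ with $B\in V_N\cup\{\varepsilon\}$; $a\gtrdot b$ if some rule is $A\to\alpha Db\beta$ with $D\in V_N$ and $a\in\mathcal R_G(D)$; $a\lessdot b$ if some rule is $A\to\alpha aD\beta$ with $D\in V_N$ and $b\in\mathcal L_G(D)$. The operator precedence matrix $OPM(G)$ assigns to each pair $(a,b)$ the set of the relations that hold between $a$ and $b$. An operator grammar $G$ is a *Floyd grammar* (FG) if each entry of $OPM(G)$ has at most one element. A *VP alphabet* $\widehat\Sigma=\langle\Sigma_c,\Sigma_r,\Sigma_i\rangle$ is a partition of $\Sigma$ into three (possibly empty) sets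 of calls, returns and internal letters. Its *total VP matrix* $M_T$ has $M_T[a,b]=\{\lessdot\}$ for $a\in\Sigma_c$, $b\in\Sigma_c\cup\Sigma_i$; $M_T[a,b]=\{\doteq\}$ for $a\in\Sigma_c$, $b\in\Sigma_r$; and $M_T[a,b]=\{\gtrdot\}$ for $a\in\Sigma_r\cup\Sigma_i$, $b\in\Sigma$. A *VP matrix* is a matrix contained entrywise in the total VP matrix of some VP alphabet on $\Sigma$. A *visibly pushdown automaton* (VPDA) over $\widehat\Sigma$ has finite sets $Q$ of states and $\Gamma\ni\bot$ of stack symbols, an initial state $q_0$, final states $F\subseteq Q$, and a transition relation $\delta\subseteq (Q\times\Sigma_c\times Q\times(\Gamma\setminus\{\bot\}))\cup(Q\times\Sigma_r\times\Gamma\times Q)\cup(Q\times\Sigma_i\times Q)$: a call pushes a symbol, a return pops the top symbol (or leaves $\bot$ in place if the stack is just $\bot$), and an internal letter does not touch the stack. It starts in $q_0$ with stack $\bot$ and accepts by final state, with any stack contents. A *VPDA language* over $\Sigma$ is the language of a VPDA over some VP alphabet on $\Sigma$. **Theorem.** 1. Let $G$ be a Floyd grammar such that $OPM(G)$ is a VP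 matrix. Then $L(G)$ is a VPDA language; more precisely, for every VP alphabet $\widehat\Sigma$ whose total VP matrix contains $OPM(G)$, there is a VPDA over $\widehat\Sigma$ that recognizes $L(G)$. 2. The construction is effective: there is a computable function that maps every (finite description of a) Floyd grammar $G$ such that $OPM(G)$ is a VP matrix to (a finite description of) a VP alphabet whose total VP matrix contains $OPM(G)$ and a VPDA over it that recognizes $L(G)$. 3. Consequently, a language $L\subseteq\Sigma^*$ is a VPDA language if and only if $L=L(G)$ for some Floyd grammar $G$ over $\Sigma$ such that $OPM(G)$ is a VP matrix. -/

import Mathlib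

/-! ### Operator precedence (Floyd) grammars -/

namespace ContextFreeGrammar

variable {T : Type*}

/-- Operator form: no right part contains two adjacent nonterminals. -/
def IsOperator (g : ContextFreeGrammar T) : Prop :=
  ∀ r ∈ g.rules, ¬ ∃ (α β : List (Symbol T g.NT)) (A B : g.NT),
    r.output = α ++ Symbol.nonterminal A :: Symbol.nonterminal B :: β

/-- An element of `V_N ∪ {ε}`, read as a string of length at most one. -/
def optNT {N : Type*} (B : Option N) : List (Symbol T N) :=
  (B.map Symbol.nonterminal).toList

/-- The left terminal set of `A`: the letters `a` with `A ⇒* B a α`, `B ∈ V_N ∪ {ε}`. -/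
def leftSet (g : ContextFreeGrammar T) (A : g.NT) : Set T :=
  {a | ∃ (B : Option g.NT) (α : List (Symbol T g.NT)),
    g.Derives [Symbol.nonterminal A] (optNT B ++ Symbol.terminal a :: α)}

/-- The right terminal set of `A`: the letters `a` with `A ⇒* α a B`, `B ∈ V_N ∪ {ε}`. -/
def rightSet (g : ContextFreeGrammar T) (A : g.NT) : Set T :=
  {a | ∃ (B : Option g.NT) (α : List (Symbol T g.NT)),
    g.Derives [Symbol.nonterminal A] (α ++ Symbol.terminal a :: optNT B)}

end ContextFreeGrammar

/-- The three operator precedence relations: `lt` is `⋖`, `eq` is `≐`, `gt` is `⋗`. -/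
inductive PrecRel
  | lt
  | eq
  | gt

/-- A precedence matrix over the alphabet `T`. -/
abbrev PrecMatrix (T : Type*) := T → T → Set PrecRel

namespace ContextFreeGrammar

variable {T : Type*}

/-- `g.Prec ρ a b`: the precedence relation `ρ` holds between the letters `a` and `b`. -/
def Prec (g : ContextFreeGrammar T) : PrecRel → T → T → Prop
  | .eq, a, b => ∃ r ∈ g.rules, ∃ (α β : List (Symbol T g.NT)) (B : Option g.NT),
      r.output = α ++ Symbol.terminal a :: (optNT B ++ Symbol.terminal b :: β)
  | .gt, a, b => ∃ r ∈ g.rules, ∃ (α β : List (Symbol T g.NT)) (D : g.NT),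
      r.output = α ++ Symbol.nonterminal D :: Symbol.terminal b :: β ∧ a ∈ g.rightSet D
  | .lt, a, b => ∃ r ∈ g.rules, ∃ (α β : List (Symbol T g.NT)) (D : g.NT),
      r.output = α ++ Symbol.terminal a :: Symbol.nonterminal D :: β ∧ b ∈ g.leftSet D

/-- The operator precedence matrix of a grammar. -/
def opm (g : ContextFreeGrammar T) : PrecMatrix T :=
  fun a b => {ρ | g.Prec ρ a b}

/-- Floyd grammar: an operator grammar whose precedence matrix is conflict-free. -/
def IsFloyd (g : ContextFreeGrammar T) : Prop :=
  g.IsOperator ∧ ∀ a b : T, (g.opm a b).Subsingleton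

end ContextFreeGrammar

/-! ### VP alphabets and VP matrices -/

/-- The classes of letters of a visibly pushdown alphabet. A VP alphabet over `T` (a partition of
`T` into calls, returns and internals) is a map `κ : T → LetterKind`. -/
inductive LetterKind
  | call
  | ret
  | internal

/-- The entries of the total VP matrix, by the classes of the row and of the column. -/
def LetterKind.rel : LetterKind → LetterKind → PrecRel
  | .call, .call => .lt
  | .call, .ret => .eq
  | .call, .internal => .lt
  | .ret, _ => .gt
  | .internal, _ => .gt

/-- The total VP matrix that represents the VP alphabet `κ`. -/
def totalVPMatrix {T : Type*} (κ : T → LetterKind) : PrecMatrix T :=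
  fun a b => {(κ a).rel (κ b)}

/-- The entrywise inclusion of `M` in the total VP matrix that represents `κ`. -/
def IsVPMatrixFor {T : Type*} (κ : T → LetterKind) (M : PrecMatrix T) : Prop :=
  ∀ a b : T, M a b ⊆ totalVPMatrix κ a b

/-- `M` is a VP matrix: it is contained in the total VP matrix of some VP alphabet. -/
def IsVPMatrix {T : Type*} (M : PrecMatrix T) : Prop :=
  ∃ κ : T → LetterKind, IsVPMatrixFor κ M

/-! ### Visibly pushdown automata -/

/-- A (nondeterministic) visibly pushdown automaton over the VP alphabet `κ`. `Stack` is the set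
of stack symbols other than the bottom symbol `⊥`; in `retTrans`, `none` stands for `⊥`. -/
structure VPDA (T : Type*) (κ : T → LetterKind) where
  State : Type
  Stack : Type
  finite_state : Finite State
  finite_stack : Finite Stack
  start : State
  accept : Set State
  callTrans : Set (State × {a : T // κ a = .call} × State × Stack)
  retTrans : Set (State × {a : T // κ a = .ret} × Option Stack × State)
  intTrans : Set (State × {a : T // κ a = .internal} × State)

namespace VPDA

variable {T : Type*} {κ : T → LetterKind}

/-- One move. A configuration is a state with the stack contents above `⊥`, top first. A call
pushes one symbol, a return pops the top symbol (or tests for `⊥` and leaves it in place), an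
internal letter leaves the stack alone. -/
inductive Step (A : VPDA T κ) : A.State × List A.Stack → T → A.State × List A.Stack → Prop
  | call {q a q' Z} (σ : List A.Stack) (h : (q, a, q', Z) ∈ A.callTrans) :
      Step A (q, σ) a.1 (q', Z :: σ)
  | pop {q a q' Z} (σ : List A.Stack) (h : (q, a, some Z, q') ∈ A.retTrans) :
      Step A (q, Z :: σ) a.1 (q', σ)
  | bottom {q a q'} (h : (q, a, none, q') ∈ A.retTrans) :
      Step A (q, []) a.1 (q', [])
  | internal {q a q'} (σ : List A.Stack) (h : (q, a, q') ∈ A.intTrans) :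
      Step A (q, σ) a.1 (q', σ)

/-- `A.Run x w y`: the word `w` labels a path from the configuration `x` to `y`. -/
inductive Run (A : VPDA T κ) :
    A.State × List A.Stack → List T → A.State × List A.Stack → Prop
  | nil (x) : Run A x [] x
  | cons {x y z a w} (h : A.Step x a y) (h' : Run A y w z) : Run A x (a :: w) z

/-- The language recognized by final state (with any stack contents) from `(q₀, ⊥)`. -/
def language (A : VPDA T κ) : Language T :=
  {w | ∃ q ∈ A.accept, ∃ σ : List A.Stack, A.Run (A.start, []) w (q, σ)}

end VPDA

/-- `L` is recognized by a visibly pushdown automaton, for some VP alphabet over `T`. -/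
def IsVPDALanguage {T : Type*} (L : Language T) : Prop :=
  ∃ (κ : T → LetterKind) (A : VPDA T κ), A.language = L

/-! ### Finite descriptions of grammars and automata, as data for algorithms -/

/-- A finite description of a context-free grammar whose nonterminals are numbers: the axiom and
the list of rules; in a right part, `Sum.inl` marks letters and `Sum.inr` nonterminals. -/
structure GrammarCode (T : Type*) where
  initial : ℕ
  rules : List (ℕ × List (T ⊕ ℕ))

namespace GrammarCode

variable {T : Type*}

def equivProd (T : Type*) : GrammarCode T ≃ ℕ × List (ℕ × List (T ⊕ ℕ)) where
  toFun c := (c.initial, c.rules)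
  invFun p := ⟨p.1, p.2⟩
  left_inv _ := rfl
  right_inv _ := rfl

instance [Primcodable T] : Primcodable (GrammarCode T) :=
  Primcodable.ofEquiv _ (equivProd T)

open Classical in
/-- The grammar described by a code. -/
noncomputable def toGrammar (c : GrammarCode T) : ContextFreeGrammar T where
  NT := ℕ
  initial := c.initial
  rules := (c.rules.map fun r =>
    (⟨r.1, r.2.map (Sum.elim Symbol.terminal Symbol.nonterminal)⟩ : ContextFreeRule T ℕ)).toFinset

end GrammarCode

/-- A finite description of a visibly pushdown automaton: the lists of calls and of returns (all
other letters are internal), the states `0, …, maxState` with initial state `0`, the number of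
stack symbols other than `⊥`, the list of final states, and the lists of transitions. -/
structure VPDACode (T : Type*) where
  calls : List T
  returns : List T
  maxState : ℕ
  numStack : ℕ
  accept : List ℕ
  callTrans : List (ℕ × T × ℕ × ℕ)
  retTrans : List (ℕ × T × Option ℕ × ℕ)
  intTrans : List (ℕ × T × ℕ)

namespace VPDACode

variable {T : Type*}

def equivProd (T : Type*) : VPDACode T ≃
    List T × List T × ℕ × ℕ × List ℕ × List (ℕ × T × ℕ × ℕ) ×
      List (ℕ × T × Option ℕ × ℕ) × List (ℕ × T × ℕ) where
  toFun c := (c.calls, c.returns, c.maxState, c.numStack, c.accept, c.callTrans, c.retTrans,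
    c.intTrans)
  invFun p := ⟨p.1, p.2.1, p.2.2.1, p.2.2.2.1, p.2.2.2.2.1, p.2.2.2.2.2.1, p.2.2.2.2.2.2.1,
    p.2.2.2.2.2.2.2⟩
  left_inv _ := rfl
  right_inv _ := rfl

instance [Primcodable T] : Primcodable (VPDACode T) :=
  Primcodable.ofEquiv _ (equivProd T)

open Classical in
/-- The VP alphabet described by a code. -/
noncomputable def kind (c : VPDACode T) (a : T) : LetterKind :=
  if a ∈ c.calls then .call else if a ∈ c.returns then .ret else .internal

/-- The automaton described by a code. -/
def toVPDA (c : VPDACode T) : VPDA T c.kind where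
  State := Fin (c.maxState + 1)
  Stack := Fin c.numStack
  finite_state := inferInstance
  finite_stack := inferInstance
  start := 0
  accept := {q | q.val ∈ c.accept}
  callTrans := {t | (t.1.val, t.2.1.val, t.2.2.1.val, t.2.2.2.val) ∈ c.callTrans}
  retTrans := {t | (t.1.val, t.2.1.val, t.2.2.1.map Fin.val, t.2.2.2.val) ∈ c.retTrans}
  intTrans := {t | (t.1.val, t.2.1.val, t.2.2.val) ∈ c.intTrans}

end VPDACode

/-! From grammars to automata. In a VP matrix `a ≐ b` forces `a` to be a call and `b` a return, so a
right part has one of the shapes `P`, `P a E`, `P a Q b E`, with `P`, `Q`, `E` nonterminals or empty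
(`rule_shape`). The other two relations restrict these nonterminals: after a letter that is not a
call, `E` can contribute only the empty word; before a letter, a right set contains no call; after a
call, a left set contains no return. Hence `P a Q b E` matches the call `a` with the return `b`, a
call in a one-letter rule stays pending for ever, and a return in a one-letter rule is read on the
empty stack.

So a bottom-up parser can obey the visible stack discipline. Its state holds a goal, which has to
derive everything after the last pending call, and an element `p` of `V_N ∪ {ε}` that derives what
has been read since the last open call. At a call the parser guesses. If the call is to be matched,
the state and the letter are pushed, and there is no goal until the match; if it is pending, the
goal `x` is expanded to `P a y` and `y` is the new goal. Every other letter triggers a reduction.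
Soundness is an invariant of the runs (`parseInv_step`). For completeness, the words that the parser
can read interpret the nonterminals in a way that respects all rules (`readable_of_rule`).

Empty and renaming rules are absorbed by a relation `R` between `V_N ∪ {ε}` and forms. `IsParser`
leaves `R` abstract, so that one proof serves two parsers: with derivability for mere existence, and
with the rewriting of forms as a whole, computed as a finite transitive closure, for the algorithm.
The algorithm takes as calls the rows of `≐` and `⋖`, and as returns the columns of `≐`: every
suitable VP alphabet must contain these.

From automata to grammars. Left-recursive nonterminals generate the words read at one stack level,
and right-recursive ones attach the pending calls; the precedences are read off the few rule
schemes. -/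

namespace ContextFreeGrammar

variable {T : Type*}

/-! ### Interpretations of sentential forms. -/

@[simp]
theorem optNT_none {N : Type*} : (optNT none : List (Symbol T N)) = [] := rfl

@[simp]
theorem optNT_some {N : Type*} (B : N) :
    (optNT (some B) : List (Symbol T N)) = [Symbol.nonterminal B] := rfl

/-- The interpretation of sentential forms given by an interpretation of the nonterminals. -/
def formVal {N : Type*} (val : N → Language T) : List (Symbol T N) → Language T
  | [] => {w | w = []}
  | Symbol.terminal a :: s => {w | ∃ v ∈ formVal val s, w = a :: v}
  | Symbol.nonterminal A :: s => {w | ∃ u ∈ val A, ∃ v ∈ formVal val s, w = u ++ v}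

section formVal

variable {N : Type*} {val : N → Language T} {w : List T}

@[simp]
theorem mem_formVal_nil : w ∈ formVal val [] ↔ w = [] := Iff.rfl

@[simp]
theorem mem_formVal_terminal {a : T} {s : List (Symbol T N)} :
    w ∈ formVal val (Symbol.terminal a :: s) ↔ ∃ v ∈ formVal val s, w = a :: v := Iff.rfl

@[simp]
theorem mem_formVal_nonterminal {A : N} {s : List (Symbol T N)} :
    w ∈ formVal val (Symbol.nonterminal A :: s) ↔
      ∃ u ∈ val A, ∃ v ∈ formVal val s, w = u ++ v := Iff.rfl

theorem mem_formVal_append {s t : List (Symbol T N)} :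
    w ∈ formVal val (s ++ t) ↔ ∃ u ∈ formVal val s, ∃ v ∈ formVal val t, w = u ++ v := by
  induction s generalizing w with
  | nil => simp
  | cons x s ih =>
    cases x with
    | terminal a =>
      simp only [List.cons_append, mem_formVal_terminal, ih]
      constructor
      · rintro ⟨_, ⟨u, hu, v, hv, rfl⟩, rfl⟩
        exact ⟨_, ⟨u, hu, rfl⟩, v, hv, rfl⟩
      · rintro ⟨_, ⟨u, hu, rfl⟩, v, hv, rfl⟩
        exact ⟨_, ⟨u, hu, v, hv, rfl⟩, rfl⟩
    | nonterminal A =>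
      simp only [List.cons_append, mem_formVal_nonterminal, ih]
      constructor
      · rintro ⟨x, hx, _, ⟨u, hu, v, hv, rfl⟩, rfl⟩
        exact ⟨_, ⟨x, hx, u, hu, rfl⟩, v, hv, by simp⟩
      · rintro ⟨_, ⟨x, hx, u, hu, rfl⟩, v, hv, rfl⟩
        exact ⟨x, hx, _, ⟨u, hu, v, hv, rfl⟩, by simp⟩

theorem mem_formVal_map_terminal (w : List T) : w ∈ formVal val (w.map Symbol.terminal) := by
  induction w with
  | nil => simp
  | cons a w ih => exact ⟨w, ih, rfl⟩

end formVal

variable {g : ContextFreeGrammar T}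

/-- An interpretation of the nonterminals that respects every rule respects every derivation. -/
theorem formVal_le_of_derives {val : g.NT → Language T}
    (h : ∀ r ∈ g.rules, ∀ w ∈ formVal val r.output, w ∈ val r.input)
    {s t : List (Symbol T g.NT)} (hst : g.Derives s t) {w : List T} (hw : w ∈ formVal val t) :
    w ∈ formVal val s := by
  induction hst using Relation.ReflTransGen.head_induction_on with
  | refl => exact hw
  | head hp _ ih =>
    obtain ⟨r, hr, hrw⟩ := hp
    obtain ⟨p, q, rfl, rfl⟩ := hrw.exists_parts
    rw [mem_formVal_append] at ih ⊢
    obtain ⟨u, hu, v, hv, rfl⟩ := ih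
    obtain ⟨u₁, hu₁, u₂, hu₂, rfl⟩ := mem_formVal_append.1 hu
    exact ⟨_, mem_formVal_append.2 ⟨u₁, hu₁, u₂, ⟨u₂, h r hr _ hu₂, [], rfl, by simp⟩, rfl⟩,
      v, hv, rfl⟩

/-- A language that contains the words of an interpretation of the axiom respecting the rules. -/
theorem mem_val_initial {val : g.NT → Language T}
    (h : ∀ r ∈ g.rules, ∀ w ∈ formVal val r.output, w ∈ val r.input)
    {w : List T} (hw : w ∈ g.language) : w ∈ val g.initial := by
  obtain ⟨u, hu, v, rfl, rfl⟩ := formVal_le_of_derives h hw (mem_formVal_map_terminal w)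
  simpa using hu

theorem derives_rule {r : ContextFreeRule T g.NT} (hr : r ∈ g.rules) :
    g.Derives [Symbol.nonterminal r.input] r.output :=
  Relation.ReflTransGen.single ⟨r, hr, ContextFreeRule.Rewrites.input_output⟩

theorem Derives.append {s s' t t' : List (Symbol T g.NT)} (h : g.Derives s s')
    (h' : g.Derives t t') : g.Derives (s ++ t) (s' ++ t') :=
  (h.append_right t).trans (h'.append_left s')

theorem Derives.cons {t t' : List (Symbol T g.NT)} (x : Symbol T g.NT)
    (h : g.Derives t t') : g.Derives (x :: t) (x :: t') :=
  h.append_left [x]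

/-! ### Left and right terminal sets -/

theorem mem_leftSet_of_rule {r : ContextFreeRule T g.NT} (hr : r ∈ g.rules) {B : Option g.NT}
    {a : T} {s : List (Symbol T g.NT)} (h : r.output = optNT B ++ Symbol.terminal a :: s) :
    a ∈ g.leftSet r.input :=
  ⟨B, s, h ▸ derives_rule hr⟩

theorem leftSet_subset_of_rule {r : ContextFreeRule T g.NT} (hr : r ∈ g.rules) {B : g.NT}
    {s : List (Symbol T g.NT)} (h : r.output = Symbol.nonterminal B :: s) :
    g.leftSet B ⊆ g.leftSet r.input := by
  rintro a ⟨C, t, ht⟩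
  refine ⟨C, t ++ s, (derives_rule hr).trans ?_⟩
  rw [h]
  simpa using ht.append_right s

theorem rightSet_eq_leftSet_reverse (A : g.NT) : g.rightSet A = g.reverse.leftSet A := by
  ext a
  constructor
  · rintro ⟨B, s, h⟩
    have e : optNT B ++ Symbol.terminal a :: s.reverse =
        (s ++ Symbol.terminal a :: optNT B).reverse := by cases B <;> simp
    exact ⟨B, s.reverse, e ▸ h.reverse⟩
  · rintro ⟨B, s, h⟩
    have e : optNT B ++ Symbol.terminal a :: s =
        (s.reverse ++ Symbol.terminal a :: optNT B).reverse := by cases B <;> simp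
    rw [e] at h
    exact ⟨B, s.reverse, derives_reverse.1 h⟩

theorem mem_rightSet_of_rule {r : ContextFreeRule T g.NT} (hr : r ∈ g.rules) {B : Option g.NT}
    {a : T} {s : List (Symbol T g.NT)} (h : r.output = s ++ Symbol.terminal a :: optNT B) :
    a ∈ g.rightSet r.input :=
  ⟨B, s, h ▸ derives_rule hr⟩

theorem rightSet_subset_of_rule {r : ContextFreeRule T g.NT} (hr : r ∈ g.rules) {B : g.NT}
    {s : List (Symbol T g.NT)} (h : r.output = s ++ [Symbol.nonterminal B]) :
    g.rightSet B ⊆ g.rightSet r.input := by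
  rintro a ⟨C, t, ht⟩
  refine ⟨C, s ++ t, (derives_rule hr).trans ?_⟩
  rw [h]
  simpa using ht.append_left s

/-- The form `s` consists of at most one nonterminal of `D`, or is led by a letter in `ok`, possibly
after one nonterminal of `D`. -/
def LedBy {N : Type*} (D : Set N) (ok : Set T) (s : List (Symbol T N)) : Prop :=
  ∃ B : Option N, (∀ A ∈ B, A ∈ D) ∧
    (s = optNT B ∨ ∃ a ∈ ok, ∃ t, s = optNT B ++ Symbol.terminal a :: t)

theorem LedBy.produces {D : Set g.NT} {ok : Set T}
    (h : ∀ r ∈ g.rules, r.input ∈ D → LedBy D ok r.output) {s t : List (Symbol T g.NT)}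
    (hs : LedBy D ok s) (hst : g.Produces s t) : LedBy D ok t := by
  obtain ⟨r, hr, hrw⟩ := hst
  obtain ⟨B, hB, rfl | ⟨a, ha, s', rfl⟩⟩ := hs
  · cases B with
    | none => cases hrw
    | some A =>
      cases hrw with
      | head => simpa using h r hr (hB _ rfl)
      | cons _ h' => cases h'
  · cases B with
    | none =>
      cases hrw with
      | cons _ h' => exact ⟨none, by simp, .inr ⟨a, ha, _, rfl⟩⟩
    | some A =>
      cases hrw with
      | head =>
        obtain ⟨C, hC, h' | ⟨b, hb, t, h'⟩⟩ := h r hr (hB _ rfl)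
        · exact ⟨C, hC, .inr ⟨a, ha, s', by rw [h']; simp⟩⟩
        · exact ⟨C, hC, .inr ⟨b, hb, t ++ Symbol.terminal a :: s', by rw [h']; simp⟩⟩
      | cons _ h' =>
        cases h' with
        | cons _ h'' => exact ⟨some A, hB, .inr ⟨a, ha, _, rfl⟩⟩

theorem LedBy.derives {D : Set g.NT} {ok : Set T}
    (h : ∀ r ∈ g.rules, r.input ∈ D → LedBy D ok r.output) {s t : List (Symbol T g.NT)}
    (hs : LedBy D ok s) (hst : g.Derives s t) : LedBy D ok t := by
  induction hst with
  | refl => exact hs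
  | tail _ hp ih => exact ih.produces h hp

/-- Rewriting beyond the first letter does not change what leads a form, and rewriting before it
inserts a form that is led in the same way; so `LedBy` is invariant. This bounds left sets, which
are defined by derivations, through an inspection of single rules. -/
theorem leftSet_subset {D : Set g.NT} {ok : Set T}
    (h : ∀ r ∈ g.rules, r.input ∈ D → LedBy D ok r.output) {A : g.NT} (hA : A ∈ D) :
    g.leftSet A ⊆ ok := by
  rintro a ⟨B, s, hs⟩
  have h₀ : LedBy D ok ([Symbol.nonterminal A] : List (Symbol T g.NT)) :=
    ⟨some A, by simpa using hA, .inl rfl⟩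
  obtain ⟨C, -, h' | ⟨b, hb, t, h'⟩⟩ := h₀.derives h hs
  · rcases B with _ | B <;> rcases C with _ | C <;> simp at h'
  · rcases B with _ | B <;> rcases C with _ | C <;> simp at h' <;> grind

theorem rightSet_subset {D : Set g.NT} {ok : Set T}
    (h : ∀ r ∈ g.rules, r.input ∈ D → LedBy D ok r.output.reverse) {A : g.NT} (hA : A ∈ D) :
    g.rightSet A ⊆ ok := by
  rw [rightSet_eq_leftSet_reverse]
  refine leftSet_subset (g := g.reverse) (D := D) (fun r hr hrD => ?_) hA
  obtain ⟨r', hr', rfl⟩ := Finset.mem_map.1 hr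
  exact h r' hr' hrD

/-- The letters of a form. -/
def formLetters {N : Type*} : List (Symbol T N) → List T :=
  List.filterMap fun | Symbol.terminal a => some a | Symbol.nonterminal _ => none

@[simp]
theorem formLetters_append {N : Type*} (s t : List (Symbol T N)) :
    formLetters (s ++ t) = formLetters s ++ formLetters t :=
  List.filterMap_append

@[simp]
theorem formLetters_terminal_cons {N : Type*} (a : T) (s : List (Symbol T N)) :
    formLetters (Symbol.terminal a :: s) = a :: formLetters s := rfl

@[simp]
theorem formLetters_optNT {N : Type*} (B : Option N) :
    formLetters (optNT B : List (Symbol T N)) = [] := by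
  cases B <;> rfl

theorem formLetters_of_eq {N : Type*} {s α β : List (Symbol T N)} {B : Option N} {a b : T}
    (h : s = α ++ Symbol.terminal a :: (optNT B ++ Symbol.terminal b :: β)) :
    formLetters s = formLetters α ++ a :: b :: formLetters β := by
  simp [h]

theorem optNT_subset_formTwo {N : Type*} (P Q E : Option N) (a b : T) :
    let s : List (Symbol T N) :=
      optNT P ++ Symbol.terminal a :: (optNT Q ++ Symbol.terminal b :: optNT E)
    optNT P ⊆ s ∧ optNT Q ⊆ s ∧ optNT E ⊆ s := by
  refine ⟨?_, ?_, ?_⟩ <;> exact fun x hx => by simp [hx]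

theorem optNT_subset_formOne {N : Type*} (P E : Option N) (a : T) :
    let s : List (Symbol T N) := optNT P ++ Symbol.terminal a :: optNT E
    optNT P ⊆ s ∧ optNT E ⊆ s := by
  refine ⟨?_, ?_⟩ <;> exact fun x hx => by simp [hx]

theorem eq_some_of_formOne {N : Type*} {P E : Option N} {a a' : T} {D : N}
    {α β : List (Symbol T N)} (h : optNT P ++ Symbol.terminal a' :: optNT E =
      α ++ Symbol.terminal a :: Symbol.nonterminal D :: β) : a' = a ∧ E = some D := by
  rcases P with _ | P <;> rcases E with _ | E <;> 
    rcases α with _ | ⟨x, _ | ⟨y, _ | ⟨z, l⟩⟩⟩ <;> simp_all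

/-! ### The shape of the rules -/

/-- The form `s` has no two adjacent nonterminals. -/
def OperatorForm {N : Type*} (s : List (Symbol T N)) : Prop :=
  ¬ ∃ (α β : List (Symbol T N)) (A B : N),
    s = α ++ Symbol.nonterminal A :: Symbol.nonterminal B :: β

/-- Peels off the first letter with the nonterminal that may precede it; the rest is again in
operator form, so the step can be iterated. -/
theorem OperatorForm.eq_optNT_or {N : Type*} {s : List (Symbol T N)} (hs : OperatorForm s) :
    ∃ B : Option N, s = optNT B ∨
      ∃ a t, s = optNT B ++ Symbol.terminal a :: t ∧ OperatorForm t := by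
  have tail : ∀ u v : List (Symbol T N), OperatorForm (u ++ v) → OperatorForm v := by
    rintro u _ h ⟨α, β, A, B, rfl⟩
    exact h ⟨u ++ α, β, A, B, by simp⟩
  match s with
  | [] => exact ⟨none, .inl rfl⟩
  | [Symbol.nonterminal A] => exact ⟨some A, .inl rfl⟩
  | Symbol.nonterminal A :: Symbol.nonterminal B :: s => exact absurd ⟨[], s, A, B, rfl⟩ hs
  | Symbol.nonterminal A :: Symbol.terminal a :: s =>
    exact ⟨some A, .inr ⟨a, s, rfl, tail [_, _] s hs⟩⟩
  | Symbol.terminal a :: s => exact ⟨none, .inr ⟨a, s, rfl, tail [_] s hs⟩⟩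

variable {κ : T → LetterKind}

theorem kind_of_eq (hκ : IsVPMatrixFor κ g.opm) {a b : T} (h : g.Prec .eq a b) :
    κ a = .call ∧ κ b = .ret := by
  have h' : PrecRel.eq = (κ a).rel (κ b) := hκ a b h
  revert h'
  rcases κ a <;> rcases κ b <;> simp [LetterKind.rel]

theorem kind_of_lt (hκ : IsVPMatrixFor κ g.opm) {a b : T} (h : g.Prec .lt a b) :
    κ a = .call ∧ κ b ≠ .ret := by
  have h' : PrecRel.lt = (κ a).rel (κ b) := hκ a b h
  revert h'
  rcases κ a <;> rcases κ b <;> simp [LetterKind.rel]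

theorem kind_of_gt (hκ : IsVPMatrixFor κ g.opm) {a b : T} (h : g.Prec .gt a b) :
    κ a ≠ .call := by
  have h' : PrecRel.gt = (κ a).rel (κ b) := hκ a b h
  revert h'
  rcases κ a <;> rcases κ b <;> simp [LetterKind.rel]

/-- A right part of an operator grammar with a VP matrix has at most two letters. -/
theorem rule_shape (hg : g.IsOperator) (hκ : IsVPMatrixFor κ g.opm)
    {r : ContextFreeRule T g.NT} (hr : r ∈ g.rules) :
    (∃ B, r.output = optNT B) ∨
    (∃ P a E, r.output = optNT P ++ Symbol.terminal a :: optNT E) ∨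
    ∃ P a Q b E, r.output =
      optNT P ++ Symbol.terminal a :: (optNT Q ++ Symbol.terminal b :: optNT E) := by
  obtain ⟨P, h | ⟨a, t, h, h₁⟩⟩ := OperatorForm.eq_optNT_or (hg r hr)
  · exact .inl ⟨P, h⟩
  obtain ⟨Q, rfl | ⟨b, t, rfl, h₂⟩⟩ := h₁.eq_optNT_or
  · exact .inr (.inl ⟨P, a, Q, h⟩)
  obtain ⟨E, rfl | ⟨c, t, rfl, -⟩⟩ := h₂.eq_optNT_or
  · exact .inr (.inr ⟨P, a, Q, b, E, h⟩)
  have hab : g.Prec .eq a b := ⟨r, hr, optNT P, _, Q, h⟩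
  have hbc : g.Prec .eq b c :=
    ⟨r, hr, optNT P ++ Symbol.terminal a :: optNT Q, t, E, by rw [h]; simp⟩
  -- The middle one of three letters would be both a return and a call.
  have := (kind_of_eq hκ hab).2.symm.trans (kind_of_eq hκ hbc).1
  cases this

end ContextFreeGrammar

/-! ### Runs of pushdown automata. -/

namespace VPDA

variable {T : Type*} {κ : T → LetterKind} {A : VPDA T κ}

theorem Run.single {x y : A.State × List A.Stack} {a : T} (h : A.Step x a y) : A.Run x [a] y :=
  .cons h (.nil y)

theorem Run.append {x y z : A.State × List A.Stack} {u v : List T} (h : A.Run x u y)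
    (h' : A.Run y v z) : A.Run x (u ++ v) z := by
  induction h with
  | nil => exact h'
  | cons hs _ ih => exact .cons hs (ih h')

/-- A family of configurations, indexed by the word read so far, that is stable under the moves
is stable under the runs. -/
theorem Run.induction {P : A.State × List A.Stack → List T → Prop}
    (hP : ∀ x u a y, P x u → A.Step x a y → P y (u ++ [a])) {x y : A.State × List A.Stack}
    {w : List T} (h : A.Run x w y) : ∀ u, P x u → P y (u ++ w) := by
  induction h with
  | nil => simp
  | cons hs _ ih =>
    intro u hu
    simpa using ih _ (hP _ u _ _ hu hs)

end VPDA

/-! ### Abstract parsers: soundness and completeness. -/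

namespace ContextFreeGrammar

variable {T : Type*} {g : ContextFreeGrammar T}

/-- The letter `a` occurs in a rule of `g`. -/
def Occurs (g : ContextFreeGrammar T) (a : T) : Prop :=
  ∃ r ∈ g.rules, Symbol.terminal a ∈ r.output

section

variable (O : Set (Option g.NT)) (R : Option g.NT → List (Symbol T g.NT) → Prop)

/-- `p a` reduces to `p'`. -/
def ReducesOne (p : Option g.NT) (a : T) (p' : Option g.NT) : Prop :=
  ∃ P ∈ O, ∃ E ∈ O, R p' (optNT P ++ Symbol.terminal a :: optNT E) ∧ R P (optNT p) ∧ R E []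

/-- `p a q b` reduces to `p'`. -/
def ReducesTwo (p : Option g.NT) (a : T) (q : Option g.NT) (b : T) (p' : Option g.NT) : Prop :=
  ∃ P ∈ O, ∃ Q ∈ O, ∃ E ∈ O,
    R p' (optNT P ++ Symbol.terminal a :: (optNT Q ++ Symbol.terminal b :: optNT E)) ∧
      R P (optNT p) ∧ R Q (optNT q) ∧ R E []

/-- `x` expands to `p a y`, so that after `p a` the goal `x` becomes the goal `y`. -/
def ExpandsTo (x p : Option g.NT) (a : T) (y : Option g.NT) : Prop :=
  ∃ P ∈ O, R x (optNT P ++ Symbol.terminal a :: optNT y) ∧ R P (optNT p)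

end

/-- The pairs of a goal (if there is one) and of an element of `V_N ∪ {ε}` that derives what has
been read since the last pending call. -/
abbrev ParseState (N : Type*) := Option (Option N) × Option N

/-- The pushdown automaton `A` parses `g`: its states decode to pairs of a goal, absent when the
last pending call has to be matched, and of an element of `O ⊆ V_N ∪ {ε}`; its stack symbols
decode to a state with a letter for calls to be matched, and to `none` for the other calls. -/
structure IsParser {κ : T → LetterKind} (g : ContextFreeGrammar T) (A : VPDA T κ)
    (O : Set (Option g.NT)) (R : Option g.NT → List (Symbol T g.NT) → Prop)
    (dec : A.State → ParseState g.NT) (decS : A.Stack → Option (ParseState g.NT × T)) : Prop where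
  sound : ∀ x s, R x s → g.Derives (optNT x) s
  refl : ∀ x, R x (optNT x)
  trans : ∀ x D s, R x [Symbol.nonterminal D] → R (some D) s → R x s
  rule : ∀ r ∈ g.rules, R (some r.input) r.output
  none_mem : none ∈ O
  initial_mem : some g.initial ∈ O
  input_mem : ∀ r ∈ g.rules, some r.input ∈ O
  output_mem : ∀ r ∈ g.rules, ∀ D, Symbol.nonterminal D ∈ r.output → some D ∈ O
  dec_start : dec A.start = (some (some g.initial), none)
  accept_iff : ∀ q, q ∈ A.accept ↔ ∃ x, (dec q).1 = some x ∧ R x (optNT (dec q).2)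
  call_iff : ∀ q a q' Z, (q, a, q', Z) ∈ A.callTrans ↔ g.Occurs a ∧
    ((dec q' = (none, none) ∧ decS Z = some (dec q, a.1)) ∨
      (decS Z = none ∧ ∃ x y, (dec q).1 = some x ∧ dec q' = (some y, none) ∧
        ExpandsTo O R x (dec q).2 a y))
  pop_iff : ∀ q b q' Z, (q, b, some Z, q') ∈ A.retTrans ↔ g.Occurs b ∧
    ∃ p a, decS Z = some (((dec q').1, p), a) ∧ ReducesTwo O R p a (dec q).2 b (dec q').2
  bottom_iff : ∀ q b q', (q, b, none, q') ∈ A.retTrans ↔ g.Occurs b ∧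
    (dec q').1 = (dec q).1 ∧ ReducesOne O R (dec q).2 b (dec q').2
  internal_iff : ∀ q a q', (q, a, q') ∈ A.intTrans ↔ g.Occurs a ∧
    (dec q').1 = (dec q).1 ∧ ReducesOne O R (dec q).2 a (dec q').2
  exists_current : ∀ q, ∀ y ∈ O, ∃ q', dec q' = ((dec q).1, y)
  exists_locked : ∃ q, dec q = (none, none)
  exists_goal : ∀ x ∈ O, ∃ q, dec q = (some x, none)
  exists_stack_none : ∃ Z, decS Z = none
  exists_stack_some : ∀ q a, g.Occurs a → ∃ Z, decS Z = some (dec q, a)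

/-- What has been read, `w`, agrees with the decoded state and stack. -/
inductive ParseInv (g : ContextFreeGrammar T) :
    ParseState g.NT → List (Option (ParseState g.NT × T)) → List T → Prop
  -- The word `u` ends with the last pending call. The stack below that call is never reached again,
  -- so only its top symbol is constrained: it is not a call to be matched.
  | goal {x p σ u v}
      (hu : g.Derives [Symbol.nonterminal g.initial] (u.map Symbol.terminal ++ optNT x))
      (hv : g.Derives (optNT p) (v.map Symbol.terminal))
      (hσ : ∀ z, σ.head? ≠ some (some z)) :
      ParseInv g (some x, p) σ (u ++ v)
  -- The stored state `c` satisfies the invariant for what preceded the open call `a`, so that a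
  -- matching return can resume from it.
  | locked {c a q σ u v} (hu : ParseInv g c σ u)
      (hv : g.Derives (optNT q) (v.map Symbol.terminal)) :
      ParseInv g (none, q) (some (c, a) :: σ) (u ++ a :: v)

theorem ParseInv.extend {m : Option (Option g.NT)} {p q : Option g.NT}
    {σ : List (Option (ParseState g.NT × T))} {u w : List T}
    (h : ParseInv g (m, p) σ u)
    (hq : ∀ v : List T, g.Derives (optNT p) (v.map Symbol.terminal) →
      g.Derives (optNT q) ((v ++ w).map Symbol.terminal)) :
    ParseInv g (m, q) σ (u ++ w) := by
  cases h with
  | goal hu hv hσ =>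
    rw [List.append_assoc]
    exact .goal hu (hq _ hv) hσ
  | locked hu hv =>
    rw [List.append_assoc, List.cons_append]
    exact .locked hu (hq _ hv)

namespace IsParser

variable {κ : T → LetterKind} {A : VPDA T κ} {O : Set (Option g.NT)}
  {R : Option g.NT → List (Symbol T g.NT) → Prop} {dec : A.State → ParseState g.NT}
  {decS : A.Stack → Option (ParseState g.NT × T)}

theorem derives_of_reducesOne (h : IsParser g A O R dec decS) {p p' : Option g.NT} {a : T}
    (hr : ReducesOne O R p a p') {v : List T} (hv : g.Derives (optNT p) (v.map Symbol.terminal)) :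
    g.Derives (optNT p') ((v ++ [a]).map Symbol.terminal) := by
  obtain ⟨P, -, E, -, h₁, h₂, h₃⟩ := hr
  refine (h.sound _ _ h₁).trans ?_
  simpa using ((h.sound _ _ h₂).trans hv).append ((h.sound _ _ h₃).cons (Symbol.terminal a))

theorem derives_of_reducesTwo (h : IsParser g A O R dec decS) {p q p' : Option g.NT} {a b : T}
    (hr : ReducesTwo O R p a q b p') {v w : List T}
    (hv : g.Derives (optNT p) (v.map Symbol.terminal))
    (hw : g.Derives (optNT q) (w.map Symbol.terminal)) :
    g.Derives (optNT p') ((v ++ a :: (w ++ [b])).map Symbol.terminal) := by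
  obtain ⟨P, -, Q, -, E, -, h₁, h₂, h₃, h₄⟩ := hr
  refine (h.sound _ _ h₁).trans ?_
  simpa using ((h.sound _ _ h₂).trans hv).append (Derives.cons (Symbol.terminal a)
    (((h.sound _ _ h₃).trans hw).append ((h.sound _ _ h₄).cons (Symbol.terminal b))))

/-- A call to be matched adds a `locked` layer, and popping it merges the two layers by one
reduction. A pending call moves all that has been read into the prefix of the goal. All other moves
only reduce in the current layer. -/
theorem parseInv_step (h : IsParser g A O R dec decS) {x y : A.State × List A.Stack} {u : List T}
    {a : T} (hx : ParseInv g (dec x.1) (x.2.map decS) u) (hs : A.Step x a y) :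
    ParseInv g (dec y.1) (y.2.map decS) (u ++ [a]) := by
  cases hs with
  | @call q a q' Z σ ht =>
    obtain ⟨-, ⟨h₁, h₂⟩ | ⟨h₁, x, y, h₂, h₃, P, -, h₄, h₅⟩⟩ := (h.call_iff _ _ _ _).1 ht
    · rw [List.map_cons, h₁, h₂]
      exact .locked hx (Derives.refl _)
    · rw [List.map_cons, h₁, h₃]
      generalize dec q = c at *
      generalize σ.map decS = τ at *
      cases hx with
      | locked => simp at h₂
      | goal hu hv hσ =>
        obtain rfl := Option.some.inj h₂
        -- Nothing has been read since the new pending call, so the current part is empty.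
        rw [← List.append_nil (_ ++ [a.1])]
        refine .goal ?_ (Derives.refl _) (by simp)
        refine hu.trans ?_
        have := (h.sound _ _ h₄).trans
          (((h.sound _ _ h₅).trans hv).append_right (Symbol.terminal a.1 :: optNT y))
        simpa using this.append_left _
  | @pop q b q' Z σ ht =>
    obtain ⟨-, p, a, h₁, h₂⟩ := (h.pop_iff _ _ _ _).1 ht
    rw [List.map_cons, h₁] at hx
    obtain ⟨n, q₂⟩ : ParseState g.NT := dec q
    generalize e : (some (((dec q').1, p), a) :: σ.map decS) = τ at hx
    generalize dec q = c at *
    cases hx with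
    | goal hu hv hσ => exact absurd (by rw [← e]; rfl) (hσ _)
    | locked hu hv =>
      simp only [List.cons.injEq, Option.some.injEq, Prod.mk.injEq] at e
      obtain ⟨⟨rfl, rfl⟩, rfl⟩ := e
      rw [List.append_assoc]
      exact hu.extend fun v hv' => h.derives_of_reducesTwo h₂ hv' hv
  | @bottom q b q' ht =>
    obtain ⟨-, h₁, h₂⟩ := (h.bottom_iff _ _ _).1 ht
    rw [← Prod.mk.eta (p := dec q'), h₁]
    exact hx.extend fun v hv => h.derives_of_reducesOne h₂ hv
  | @internal q a q' σ ht =>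
    obtain ⟨-, h₁, h₂⟩ := (h.internal_iff _ _ _).1 ht
    rw [← Prod.mk.eta (p := dec q'), h₁]
    exact hx.extend fun v hv => h.derives_of_reducesOne h₂ hv

theorem language_le (h : IsParser g A O R dec decS) {w : List T} (hw : w ∈ A.language) :
    w ∈ g.language := by
  obtain ⟨q, hq, σ, hrun⟩ := hw
  have h₀ : ParseInv g (dec A.start) (([] : List A.Stack).map decS) [] := by
    rw [h.dec_start]
    exact .goal (u := []) (v := []) (Derives.refl _) (Derives.refl _) (by simp)
  have h₁ := hrun.induction (P := fun x u => ParseInv g (dec x.1) (x.2.map decS) u)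
    (fun x u a y hx hs => h.parseInv_step hx hs) [] h₀
  obtain ⟨x, hx, hR⟩ := (h.accept_iff q).1 hq
  simp only [List.nil_append] at h₁
  generalize dec q = c at *
  generalize σ.map decS = τ at *
  cases h₁ with
  | locked => simp at hx
  | goal hu hv hσ =>
    obtain rfl := Option.some.inj hx
    rw [mem_language_iff, List.map_append]
    exact hu.trans (((h.sound _ _ hR).trans hv).append_left _)

variable (g A O R dec) in
/-- The words `w` derived from `D` as `A` can read them. -/
structure Readable (D : g.NT) (w : List T) : Prop where
  -- Erasure has to be visible to `R` itself, which may be smaller than derivability.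
  nil : w = [] → R (some D) []
  of_leftSet_empty : g.leftSet D = ∅ → w = []
  -- Without calls in the right set no call of `w` stays pending, so the stack is restored. An
  -- unmatched return needs the bottom of the stack, whence the alternative on `σ`.
  balanced : (∀ a ∈ g.rightSet D, κ a ≠ .call) → ∀ (q : A.State) (σ : List A.Stack),
    (dec q).2 = none → (σ = [] ∨ ∀ a ∈ g.leftSet D, κ a ≠ .ret) →
    ∃ q', (dec q').1 = (dec q).1 ∧ (dec q').2 ∈ O ∧ R (some D) (optNT (dec q').2) ∧
      A.Run (q, σ) w (q', σ)
  -- Pending calls are allowed here: `D` accounts for the whole goal, so nothing has to be read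
  -- after `w` and the stack need not be restored.
  goal : ∀ x ∈ O, R x [Symbol.nonterminal D] → ∀ (q : A.State) (σ : List A.Stack),
    dec q = (some x, none) → (σ = [] ∨ ∀ a ∈ g.leftSet D, κ a ≠ .ret) →
    ∃ q' ∈ A.accept, ∃ σ', A.Run (q, σ) w (q', σ')

variable (g A O R dec) in
/-- The words that satisfy `Readable`, for each nonterminal. -/
def readableWords : g.NT → Language T := fun D => {w | Readable g A O R dec D w}

theorem balanced_optNT (h : IsParser g A O R dec decS) {P : Option g.NT} {w : List T}
    (hw : w ∈ formVal (readableWords g A O R dec) (optNT P))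
    (hP : ∀ D ∈ P, ∀ a ∈ g.rightSet D, κ a ≠ .call)
    {q : A.State} {σ : List A.Stack} (hq : (dec q).2 = none)
    (hσ : σ = [] ∨ ∀ D ∈ P, ∀ a ∈ g.leftSet D, κ a ≠ .ret) :
    ∃ q', (dec q').1 = (dec q).1 ∧ (dec q').2 ∈ O ∧ R P (optNT (dec q').2) ∧
      A.Run (q, σ) w (q', σ) := by
  cases P with
  | none =>
    obtain rfl : w = [] := hw
    exact ⟨q, rfl, hq ▸ h.none_mem, hq ▸ h.refl none, .nil _⟩
  | some D =>
    obtain ⟨u, hu, v, rfl, rfl⟩ := hw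
    rw [List.append_nil]
    exact Readable.balanced hu (hP D rfl) q σ hq (hσ.imp_right fun h' => h' D rfl)

theorem empty_optNT (h : IsParser g A O R dec decS) {E : Option g.NT} {w : List T}
    (hw : w ∈ formVal (readableWords g A O R dec) (optNT E)) (hE : ∀ D ∈ E, g.leftSet D = ∅) :
    w = [] ∧ R E [] := by
  cases E with
  | none => exact ⟨hw, h.refl none⟩
  | some D =>
    obtain ⟨u, hu, v, rfl, rfl⟩ := hw
    have := Readable.of_leftSet_empty hu (hE D rfl)
    exact ⟨by simpa using this, Readable.nil hu this⟩

theorem mem_of_optNT (h : IsParser g A O R dec decS) {r : ContextFreeRule T g.NT}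
    (hr : r ∈ g.rules) {B : Option g.NT} (hB : optNT B ⊆ r.output) : B ∈ O := by
  cases B with
  | none => exact h.none_mem
  | some D => exact h.output_mem r hr D (hB (by simp))

/-- A left letter of `E` would make `a` the row of a `⋖`, hence a call; so `E` contributes the empty
word. The right letters of `P` stand in `⋗` to `a`, so `P` is read at one stack level, and a single
reduction on `a` completes the rule. -/
theorem exists_run_one (h : IsParser g A O R dec decS) (hκ : IsVPMatrixFor κ g.opm)
    {r : ContextFreeRule T g.NT} (hr : r ∈ g.rules) {P E : Option g.NT} {a : T}
    (e : r.output = optNT P ++ Symbol.terminal a :: optNT E) (ha : κ a ≠ .call) {w : List T}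
    (hw : w ∈ formVal (readableWords g A O R dec) r.output) {q : A.State} {σ : List A.Stack}
    (hq : (dec q).2 = none) (hσ : σ = [] ∨ ∀ a ∈ g.leftSet r.input, κ a ≠ .ret) :
    ∃ q', dec q' = ((dec q).1, some r.input) ∧ A.Run (q, σ) w (q', σ) := by
  rw [e, mem_formVal_append] at hw
  obtain ⟨u, hu, _, ⟨v, hv, rfl⟩, rfl⟩ := hw
  have hE : ∀ D ∈ E, g.leftSet D = ∅ := by
    rintro D rfl
    refine Set.eq_empty_of_forall_notMem fun b hb => ha ?_
    exact (kind_of_lt hκ (a := a) (b := b) ⟨r, hr, optNT P, [], D, e, hb⟩).1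
  obtain ⟨rfl, hRE⟩ := h.empty_optNT hv hE
  have hP : ∀ D ∈ P, ∀ b ∈ g.rightSet D, κ b ≠ .call := by
    rintro D rfl b hb
    exact kind_of_gt hκ (b := a) ⟨r, hr, [], optNT E, D, e, hb⟩
  obtain ⟨q₁, h₁, -, h₂, hrun⟩ := h.balanced_optNT hu hP hq (hσ.imp_right fun h' => by
    rintro D rfl b hb
    exact h' b (leftSet_subset_of_rule hr e hb))
  obtain ⟨q', h'⟩ := h.exists_current q (some r.input) (h.input_mem r hr)
  have hred : ReducesOne O R (dec q₁).2 a (dec q').2 := by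
    refine ⟨P, h.mem_of_optNT hr ?_, E, h.mem_of_optNT hr ?_, ?_, h₂, hRE⟩
    · simp [e]
    · rw [e]
      exact fun x hx => by simp [hx]
    · rw [h', ← e]
      exact h.rule r hr
  have hocc : g.Occurs a := ⟨r, hr, by simp [e]⟩
  refine ⟨q', h', hrun.append (VPDA.Run.single ?_)⟩
  cases hka : κ a with
  | call => exact absurd hka ha
  | internal =>
    exact .internal (a := ⟨a, hka⟩) σ ((h.internal_iff _ _ _).2 ⟨hocc, by rw [h', h₁], hred⟩)
  | ret =>
    -- The return `a` lies in the left set of the rule's input, so only the empty stack remains.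
    obtain rfl : σ = [] := hσ.resolve_right fun h' => h' a (mem_leftSet_of_rule hr e) hka
    exact .bottom (a := ⟨a, hka⟩) ((h.bottom_iff _ _ _).2 ⟨hocc, by rw [h', h₁], hred⟩)

/-- Here `a ≐ b` makes `a` a call and `b` a return, and `E` is erased since a return is never the
row of a `⋖`. By `⋗` neither `P` nor `Q` has a call in its right set, and by `⋖` the left set of `Q`
has no return; so `Q` is read above the pushed symbol, which `b` then pops. -/
theorem exists_run_two (h : IsParser g A O R dec decS) (hκ : IsVPMatrixFor κ g.opm)
    {r : ContextFreeRule T g.NT} (hr : r ∈ g.rules) {P Q E : Option g.NT} {a b : T}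
    (e : r.output =
      optNT P ++ Symbol.terminal a :: (optNT Q ++ Symbol.terminal b :: optNT E)) {w : List T}
    (hw : w ∈ formVal (readableWords g A O R dec) r.output) {q : A.State} {σ : List A.Stack}
    (hq : (dec q).2 = none) (hσ : σ = [] ∨ ∀ a ∈ g.leftSet r.input, κ a ≠ .ret) :
    ∃ q', dec q' = ((dec q).1, some r.input) ∧ A.Run (q, σ) w (q', σ) := by
  obtain ⟨hka, hkb⟩ := kind_of_eq hκ (a := a) (b := b) ⟨r, hr, optNT P, optNT E, Q, e⟩
  rw [e, mem_formVal_append] at hw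
  obtain ⟨u, hu, _, ⟨_, hv, rfl⟩, rfl⟩ := hw
  obtain ⟨v, hv₁, _, ⟨t, ht, rfl⟩, rfl⟩ := mem_formVal_append.1 hv
  have hE : ∀ D ∈ E, g.leftSet D = ∅ := by
    rintro D rfl
    refine Set.eq_empty_of_forall_notMem fun c hc => ?_
    have := (kind_of_lt hκ (a := b) (b := c) ⟨r, hr,
      optNT P ++ Symbol.terminal a :: optNT Q, [], D, by simp [e], hc⟩).1
    simp [hkb] at this
  obtain ⟨rfl, hRE⟩ := h.empty_optNT ht hE
  have hP : ∀ D ∈ P, ∀ c ∈ g.rightSet D, κ c ≠ .call := by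
    rintro D rfl c hc
    exact kind_of_gt hκ (b := a) ⟨r, hr, [], _, D, e, hc⟩
  obtain ⟨q₁, h₁, -, h₂, hrun⟩ := h.balanced_optNT hu hP hq (hσ.imp_right fun h' => by
    rintro D rfl c hc
    exact h' c (leftSet_subset_of_rule hr e hc))
  have hocc : ∀ c, c = a ∨ c = b → g.Occurs c := by
    rintro c (rfl | rfl) <;> exact ⟨r, hr, by simp [e]⟩
  obtain ⟨q₂, hq₂⟩ := h.exists_locked
  obtain ⟨Z, hZ⟩ := h.exists_stack_some q₁ a (hocc a (.inl rfl))
  have hQ : ∀ D ∈ Q, ∀ c ∈ g.rightSet D, κ c ≠ .call := by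
    rintro D rfl c hc
    exact kind_of_gt hκ (b := b) ⟨r, hr, optNT P ++ [Symbol.terminal a], optNT E, D,
      by simp [e], hc⟩
  obtain ⟨q₃, h₃, -, h₄, hrun'⟩ := h.balanced_optNT (σ := Z :: σ) hv₁ hQ (by rw [hq₂]) <| .inr <| by
    rintro D rfl c hc
    exact (kind_of_lt hκ (a := a) (b := c) ⟨r, hr, optNT P, _, D, e, hc⟩).2
  obtain ⟨q', h'⟩ := h.exists_current q (some r.input) (h.input_mem r hr)
  have hred : ReducesTwo O R (dec q₁).2 a (dec q₃).2 b (dec q').2 := by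
    refine ⟨P, h.mem_of_optNT hr ?_, Q, h.mem_of_optNT hr ?_, E, h.mem_of_optNT hr ?_, ?_, h₂, h₄,
      hRE⟩
    · simp [e]
    · rw [e]
      exact fun x hx => by simp [hx]
    · rw [e]
      exact fun x hx => by simp [hx]
    · rw [h', ← e]
      exact h.rule r hr
  refine ⟨q', h', hrun.append (.cons ?_ (hrun'.append (VPDA.Run.single ?_)))⟩
  · exact .call (a := ⟨a, hka⟩) σ ((h.call_iff _ _ _ _).2 ⟨hocc a (.inl rfl), .inl ⟨hq₂, hZ⟩⟩)
  · refine .pop (a := ⟨b, hkb⟩) σ ((h.pop_iff _ _ _ _).2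
      ⟨hocc b (.inr rfl), (dec q₁).2, a, ?_, hred⟩)
    rw [hZ, h', ← h₁]

/-- The completeness step, by the shape of the rule. Rules without letters only compose in `R`. The
other rules end in a reduction to the rule's input, except `P a E` with a call `a`: this is excluded
in `balanced`, as `a` is in the right set, and is the pending case in `goal`. -/
theorem readable_of_rule (h : IsParser g A O R dec decS) (hg : g.IsOperator)
    (hκ : IsVPMatrixFor κ g.opm) {r : ContextFreeRule T g.NT} (hr : r ∈ g.rules) {w : List T}
    (hw : w ∈ formVal (readableWords g A O R dec) r.output) : Readable g A O R dec r.input w := by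
  have finish : ∀ {x m q' σ' q σ}, R x [Symbol.nonterminal r.input] → m = some x →
      dec q' = (m, some r.input) → A.Run (q, σ) w (q', σ') →
      ∃ q' ∈ A.accept, ∃ σ', A.Run (q, σ) w (q', σ') := by
    rintro x _ q' σ' q σ hx rfl hq' hrun
    exact ⟨q', (h.accept_iff q').2 ⟨x, by rw [hq'], by rw [hq']; exact hx⟩, σ', hrun⟩
  rcases rule_shape hg hκ hr with ⟨_ | B, e⟩ | ⟨P, a, E, e⟩ | ⟨P, a, Q, b, E, e⟩
  · rw [e] at hw
    obtain rfl : w = [] := hw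
    have hR : R (some r.input) [] := by simpa [e] using h.rule r hr
    refine ⟨fun _ => hR, fun _ => rfl, fun _ q σ hq _ => ⟨q, rfl, hq ▸ h.none_mem, hq ▸ hR, .nil _⟩,
      fun x _ hx q σ hq _ => ⟨q, (h.accept_iff q).2 ⟨x, by rw [hq], ?_⟩, σ, .nil _⟩⟩
    rw [hq]
    exact h.trans _ _ _ hx hR
  · rw [e] at hw
    obtain ⟨w, hw, v, rfl, rfl⟩ := hw
    have hR : R (some r.input) [Symbol.nonterminal B] := by simpa [e] using h.rule r hr
    have hl := leftSet_subset_of_rule (B := B) (s := []) hr e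
    have hrt := rightSet_subset_of_rule (B := B) (s := []) hr e
    rw [List.append_nil]
    refine ⟨fun hn => h.trans _ _ _ hR (Readable.nil hw hn),
      fun hn => Readable.of_leftSet_empty hw (Set.subset_eq_empty hl hn),
      fun hc q σ hq hσ => ?_, fun x hxO hx q σ hq hσ => ?_⟩
    · obtain ⟨q', h₁, h₂, h₃, h₄⟩ := Readable.balanced hw (fun a ha => hc a (hrt ha)) q σ hq
        (hσ.imp_right fun h' a ha => h' a (hl ha))
      exact ⟨q', h₁, h₂, h.trans _ _ _ hR h₃, h₄⟩
    · exact Readable.goal hw x hxO (h.trans _ _ _ hx hR) q σ hq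
        (hσ.imp_right fun h' a ha => h' a (hl ha))
  · refine ⟨?_, fun hn => ?_, fun hc q σ hq hσ => ?_, fun x hxO hx q σ hq hσ => ?_⟩
    · rintro rfl
      rw [e, mem_formVal_append] at hw
      obtain ⟨u, -, _, ⟨v, -, rfl⟩, h'⟩ := hw
      simp at h'
    · have := mem_leftSet_of_rule hr e
      simp [hn] at this
    · obtain ⟨q', h₁, h₂⟩ := h.exists_run_one hκ hr e (hc a (mem_rightSet_of_rule hr e)) hw hq hσ
      refine ⟨q', by rw [h₁], by rw [h₁]; exact h.input_mem r hr, by rw [h₁]; exact h.refl _, h₂⟩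
    · by_cases ha : κ a = .call
      · have hw' := hw
        rw [e, mem_formVal_append] at hw'
        obtain ⟨u, hu, _, ⟨v, hv, rfl⟩, rfl⟩ := hw'
        have hP : ∀ D ∈ P, ∀ c ∈ g.rightSet D, κ c ≠ .call := by
          rintro D rfl c hc
          exact kind_of_gt hκ (b := a) ⟨r, hr, [], _, D, e, hc⟩
        obtain ⟨q₁, h₁, -, h₂, hrun⟩ := h.balanced_optNT hu hP (by rw [hq])
          (hσ.imp_right fun h' => by
            rintro D rfl c hc
            exact h' c (leftSet_subset_of_rule hr e hc))
        have hEO : E ∈ O := h.mem_of_optNT hr (by rw [e]; exact fun x hx => by simp [hx])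
        obtain ⟨q₂, hq₂⟩ := h.exists_goal E hEO
        obtain ⟨Z, hZ⟩ := h.exists_stack_none
        have hstep : A.Step (q₁, σ) a (q₂, Z :: σ) := by
          refine .call (a := ⟨a, ha⟩) σ ((h.call_iff _ _ _ _).2 ⟨⟨r, hr, by simp [e]⟩, .inr
            ⟨hZ, x, E, by rw [h₁, hq], hq₂, P, h.mem_of_optNT hr (by simp [e]), ?_, h₂⟩⟩)
          rw [← e]
          exact h.trans _ _ _ hx (h.rule r hr)
        -- What remains is derived from `E`, the new goal. By `⋖` its left letters are not returns,
        -- so the nonempty stack does no harm.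
        suffices ∃ q' ∈ A.accept, ∃ σ', A.Run (q₂, Z :: σ) v (q', σ') by
          obtain ⟨q', hq', σ', hrun'⟩ := this
          exact ⟨q', hq', σ', hrun.append (.cons hstep hrun')⟩
        cases E with
        | none =>
          obtain rfl : v = [] := hv
          exact ⟨q₂, (h.accept_iff q₂).2 ⟨none, by rw [hq₂], by rw [hq₂]; exact h.refl none⟩, _,
            .nil _⟩
        | some D =>
          obtain ⟨v, hv, _, rfl, rfl⟩ := hv
          rw [List.append_nil]
          exact Readable.goal hv _ hEO (h.refl (some D)) q₂ _ hq₂ <| .inr fun c hc =>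
            (kind_of_lt hκ (a := a) (b := c) ⟨r, hr, optNT P, [], D, e, hc⟩).2
      · obtain ⟨q', h₁, h₂⟩ := h.exists_run_one hκ hr e ha hw (by rw [hq]) hσ
        exact finish hx (by rw [hq]) h₁ h₂
  · refine ⟨?_, fun hn => ?_, fun hc q σ hq hσ => ?_, fun x hxO hx q σ hq hσ => ?_⟩
    · rintro rfl
      rw [e, mem_formVal_append] at hw
      obtain ⟨u, -, _, ⟨v, -, rfl⟩, h'⟩ := hw
      simp at h'
    · have := mem_leftSet_of_rule hr e
      simp [hn] at this
    · obtain ⟨q', h₁, h₂⟩ := h.exists_run_two hκ hr e hw hq hσ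
      refine ⟨q', by rw [h₁], by rw [h₁]; exact h.input_mem r hr, by rw [h₁]; exact h.refl _, h₂⟩
    · obtain ⟨q', h₁, h₂⟩ := h.exists_run_two hκ hr e hw (by rw [hq]) hσ
      exact finish hx (by rw [hq]) h₁ h₂

theorem language_eq (h : IsParser g A O R dec decS) (hg : g.IsOperator)
    (hκ : IsVPMatrixFor κ g.opm) : A.language = g.language := by
  refine Set.Subset.antisymm (fun w hw => h.language_le hw) fun w hw => ?_
  have hw' : Readable g A O R dec g.initial w :=
    mem_val_initial (val := readableWords g A O R dec)
      (fun r hr w hw => h.readable_of_rule hg hκ hr hw)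
      hw
  obtain ⟨q', hq', σ', hrun⟩ := hw'.goal _ h.initial_mem (h.refl (some _)) A.start [] h.dec_start
    (.inl rfl)
  exact ⟨q', hq', σ', hrun⟩

end IsParser

end ContextFreeGrammar

/-! ### The parser with derivability as the reduction relation. -/

namespace ContextFreeGrammar

variable {T : Type*} (g : ContextFreeGrammar T)

/-- The nonterminals that occur in `g`. -/
def usedNT : Set g.NT :=
  {A | A = g.initial ∨ ∃ r ∈ g.rules, A = r.input ∨ Symbol.nonterminal A ∈ r.output}

/-- The type `g.NT` may be infinite; states built from the occurring nonterminals keep the automaton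
finite. -/
theorem finite_usedNT : g.usedNT.Finite := by
  have h : g.usedNT ⊆ {g.initial} ∪ ⋃ r ∈ (g.rules : Set (ContextFreeRule T g.NT)),
      ({r.input} ∪ Symbol.nonterminal ⁻¹' {x | x ∈ r.output}) := by
    rintro A (rfl | ⟨r, hr, h⟩)
    · simp
    · exact .inr (Set.mem_biUnion hr (by simpa using h))
  refine ((Set.finite_singleton _).union (g.rules.finite_toSet.biUnion fun r _ =>
    (Set.finite_singleton _).union ((r.output.finite_toSet).preimage ?_))).subset h
  exact fun A _ B _ hAB => by simpa using hAB

instance : Finite g.usedNT := g.finite_usedNT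

/-- The embedding of the states over a set of nonterminals. -/
def ParseState.incl {N : Type*} {D : Set N} (c : ParseState D) : ParseState N :=
  (c.1.map (Option.map Subtype.val), c.2.map Subtype.val)

theorem ParseState.exists_option {N : Type*} {D : Set N} {x : Option N} (h : ∀ A ∈ x, A ∈ D) :
    ∃ y : Option D, y.map Subtype.val = x := by
  cases x with
  | none => exact ⟨none, rfl⟩
  | some A => exact ⟨some ⟨A, h A rfl⟩, rfl⟩

/-- The parser of a Floyd grammar with a VP matrix. -/
noncomputable def parser [Finite T] (κ : T → LetterKind) : VPDA T κ where
  State := ParseState g.usedNT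
  -- Letters are stored by number, because `T` may live in a higher universe than `Stack`.
  Stack := Option (ParseState g.usedNT × Fin (Nat.card T))
  finite_state := inferInstance
  finite_stack := inferInstance
  start := (some (some ⟨g.initial, .inl rfl⟩), none)
  accept := {q | ∃ x, q.incl.1 = some x ∧ g.Derives (optNT x) (optNT q.incl.2)}
  callTrans := {t | g.Occurs t.2.1 ∧
    ((t.2.2.1.incl = (none, none) ∧ t.2.2.2 = some (t.1, Finite.equivFin T t.2.1)) ∨
      (t.2.2.2 = none ∧ ∃ x y, t.1.incl.1 = some x ∧ t.2.2.1.incl = (some y, none) ∧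
        ExpandsTo {z | ∀ A ∈ z, A ∈ g.usedNT} (fun x => g.Derives (optNT x)) x t.1.incl.2 t.2.1 y))}
  retTrans := {t | g.Occurs t.2.1 ∧
    ((∃ c i, t.2.2.1 = some (some (c, i)) ∧ c.incl.1 = t.2.2.2.incl.1 ∧
      ReducesTwo {z | ∀ A ∈ z, A ∈ g.usedNT} (fun x => g.Derives (optNT x))
        c.incl.2 ((Finite.equivFin T).symm i) t.1.incl.2 t.2.1 t.2.2.2.incl.2) ∨
    (t.2.2.1 = none ∧ t.2.2.2.incl.1 = t.1.incl.1 ∧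
      ReducesOne {z | ∀ A ∈ z, A ∈ g.usedNT} (fun x => g.Derives (optNT x))
        t.1.incl.2 t.2.1 t.2.2.2.incl.2))}
  intTrans := {t | g.Occurs t.2.1 ∧ t.2.2.incl.1 = t.1.incl.1 ∧
    ReducesOne {z | ∀ A ∈ z, A ∈ g.usedNT} (fun x => g.Derives (optNT x))
      t.1.incl.2 t.2.1 t.2.2.incl.2}

theorem ParseState.incl_injective {N : Type*} {D : Set N} :
    Function.Injective (ParseState.incl (D := D)) := by
  have h := Option.map_injective (Subtype.val_injective (p := (· ∈ D)))
  rintro ⟨m, p⟩ ⟨m', p'⟩ e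
  obtain ⟨h₁, h₂⟩ := Prod.mk.inj e
  exact Prod.ext (Option.map_injective h h₁) (h h₂)

theorem isParser_parser [Finite T] (κ : T → LetterKind) :
    IsParser g (g.parser κ) {z | ∀ A ∈ z, A ∈ g.usedNT} (fun x => g.Derives (optNT x))
      ParseState.incl (Option.map (Prod.map ParseState.incl (Finite.equivFin T).symm)) where
  sound _ _ h := h
  refl _ := Derives.refl _
  trans _ _ _ h h' := h.trans h'
  rule _ hr := derives_rule hr
  none_mem := by simp
  initial_mem := by simp [usedNT]
  input_mem r hr := by
    rintro A ⟨⟩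
    exact .inr ⟨r, hr, .inl rfl⟩
  output_mem r hr D hD := by
    rintro A ⟨⟩
    exact .inr ⟨r, hr, .inr hD⟩
  dec_start := rfl
  accept_iff q := Iff.rfl
  call_iff q a q' Z := by
    refine and_congr_right fun _ => or_congr (and_congr_right fun _ => ?_)
      (and_congr_left fun _ => ?_)
    · rcases Z with _ | ⟨c, i⟩
      · simp
      · simp only [Option.some.injEq, Option.map_some, Prod.map, Prod.mk.injEq, Equiv.symm_apply_eq]
        exact Prod.mk_inj.trans (and_congr_left fun _ => ParseState.incl_injective.eq_iff.symm)
    · cases Z <;> simp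
  pop_iff q b q' Z := by
    refine and_congr_right fun _ => ?_
    rcases Z with _ | ⟨c, i⟩
    · constructor
      · rintro (⟨_, _, ⟨⟩, _⟩ | ⟨⟨⟩, _⟩)
      · rintro ⟨_, _, ⟨⟩, _⟩
    · constructor
      · rintro (⟨_, _, ⟨⟩, h₁, h₂⟩ | ⟨⟨⟩, _⟩)
        exact ⟨_, _, by rw [← h₁]; rfl, h₂⟩
      · rintro ⟨p, a, h₁, h₂⟩
        simp only [Option.map_some, Prod.map, Option.some.injEq, Prod.mk.injEq] at h₁
        obtain ⟨h₁, rfl⟩ := h₁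
        exact .inl ⟨c, i, rfl, by rw [h₁], by rw [h₁]; exact h₂⟩
  bottom_iff q b q' := by
    refine and_congr_right fun _ => ⟨?_, fun h => .inr ⟨rfl, h⟩⟩
    rintro (⟨_, _, ⟨⟩, _⟩ | ⟨-, h⟩)
    exact h
  internal_iff q a q' := Iff.rfl
  exists_current q y hy := by
    obtain ⟨y, rfl⟩ := ParseState.exists_option hy
    exact ⟨(q.1, y), rfl⟩
  exists_locked := ⟨(none, none), rfl⟩
  exists_goal x hx := by
    obtain ⟨x, rfl⟩ := ParseState.exists_option hx
    exact ⟨(some x, none), rfl⟩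
  exists_stack_none := ⟨none, rfl⟩
  exists_stack_some q a _ := ⟨some (q, Finite.equivFin T a),
    congrArg (fun b => some (ParseState.incl q, b)) ((Finite.equivFin T).symm_apply_apply a)⟩

theorem exists_vpda_language_eq [Finite T] {κ : T → LetterKind} (hg : g.IsOperator)
    (hκ : IsVPMatrixFor κ g.opm) : ∃ A : VPDA T κ, A.language = g.language :=
  ⟨g.parser κ, (g.isParser_parser κ).language_eq hg hκ⟩

end ContextFreeGrammar

/-! ### Floyd grammars for visibly pushdown automata. -/

/-- The nonterminals of the grammar of a pushdown automaton with states `Q`: `read (some p) q` for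
the words that lead from `p` to `q` at one stack level, `read none q` for those that lead from the
initial state to `q` with empty stacks, and `tail` for the words that lead to acceptance. -/
inductive RunNT (Q : Type)
  | read (o : Option Q) (q : Q)
  | tail (o : Option Q)

namespace RunNT

variable {Q : Type}

instance [Finite Q] : Finite (RunNT Q) :=
  Finite.of_injective (β := (Option Q × Q) ⊕ Option Q)
    (fun | read o q => .inl (o, q) | tail o => .inr o) (by rintro (_ | _) (_ | _) h <;> simp_all)

/-- The nonterminal generates words read from a given state. -/
def IsInner : RunNT Q → Prop
  | read o _ => o.isSome
  | tail o => o.isSome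

/-- The nonterminal generates words read at one stack level. -/
def IsRead : RunNT Q → Prop
  | read _ _ => True
  | tail _ => False

end RunNT

namespace VPDA

open ContextFreeGrammar Symbol

variable {T : Type*} {κ : T → LetterKind} (A : VPDA T κ)

/-- The rules of the grammar of a pushdown automaton. -/
inductive IsRunRule : ContextFreeRule T (RunNT A.State) → Prop
  | nil (o) : IsRunRule ⟨.read o (o.getD A.start), []⟩
  | internal {o r a q} (h : (r, a, q) ∈ A.intTrans) :
      IsRunRule ⟨.read o q, [nonterminal (.read o r), terminal a.1]⟩
  | bottom {r a q} (h : (r, a, none, q) ∈ A.retTrans) :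
      IsRunRule ⟨.read none q, [nonterminal (.read none r), terminal a.1]⟩
  | matched {o r a s Z t b q} (h : (r, a, s, Z) ∈ A.callTrans)
      (h' : (t, b, some Z, q) ∈ A.retTrans) :
      IsRunRule ⟨.read o q, [nonterminal (.read o r), terminal a.1,
        nonterminal (.read (some s) t), terminal b.1]⟩
  | last {o q} (h : q ∈ A.accept) : IsRunRule ⟨.tail o, [nonterminal (.read o q)]⟩
  | pending {o r a s Z} (h : (r, a, s, Z) ∈ A.callTrans) :
      IsRunRule ⟨.tail o,
        [nonterminal (.read o r), terminal a.1, nonterminal (.tail (some s))]⟩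

theorem finite_isRunRule [Finite T] : {r | A.IsRunRule r}.Finite := by
  have := A.finite_state
  have : Finite (Symbol T (RunNT A.State)) :=
    Finite.of_injective (β := T ⊕ RunNT A.State)
      (fun | terminal a => .inl a | nonterminal B => .inr B)
      (by rintro (_ | _) (_ | _) h <;> simp_all)
  -- The longest right part, that of `matched`, has four symbols.
  refine (((Set.finite_univ (α := RunNT A.State)).prod
    (List.finite_length_le (Symbol T (RunNT A.State)) 4)).preimage
    (f := fun r : ContextFreeRule T (RunNT A.State) => (r.input, r.output)) ?_).subset ?_
  · rintro ⟨_, _⟩ - ⟨_, _⟩ - h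
    simpa using h
  · rintro _ (_ | _ | _ | _ | _ | _) <;> simp

/-- The grammar of a pushdown automaton. -/
noncomputable def grammar [Finite T] : ContextFreeGrammar T where
  NT := RunNT A.State
  initial := .tail none
  rules := A.finite_isRunRule.toFinset

variable [Finite T]

theorem mem_rules_grammar {r : ContextFreeRule T (RunNT A.State)} :
    r ∈ A.grammar.rules ↔ A.IsRunRule r :=
  Set.Finite.mem_toFinset _

/-- The symbols that may be adjacent in the rules of the grammar of a pushdown automaton. -/
def Adjacent : Symbol T (RunNT A.State) → Symbol T (RunNT A.State) → Prop
  | terminal _, terminal _ => False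
  | terminal a, nonterminal B => κ a = .call ∧ B.IsInner
  | nonterminal B, terminal _ => B.IsRead
  | nonterminal _, nonterminal _ => False

/-- One chain condition on the right parts provides the operator form and the contexts in which `⋖`
and `⋗` can arise. -/
theorem adjacent_of_rule {r : ContextFreeRule T (RunNT A.State)} (hr : r ∈ A.grammar.rules)
    {α β : List (Symbol T (RunNT A.State))} {x y : Symbol T (RunNT A.State)}
    (h : r.output = α ++ x :: y :: β) : A.Adjacent x y := by
  have hc : r.output.IsChain A.Adjacent := by
    obtain _ | _ | _ | @⟨o, r, a⟩ | _ | @⟨o, r, a⟩ := A.mem_rules_grammar.1 hr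
    case matched => simp [Adjacent, RunNT.IsInner, RunNT.IsRead, a.2]
    case pending => simp [Adjacent, RunNT.IsInner, RunNT.IsRead, a.2]
    all_goals simp [Adjacent, RunNT.IsRead]
  rw [h] at hc
  exact (List.isChain_append_cons_cons.1 hc).2.1

/-- A leading nonterminal inherits the index `o`, and only `bottom`, which needs `o = none`, has a
return as its first letter. -/
theorem leftSet_grammar {B : RunNT A.State} (hB : B.IsInner) :
    A.grammar.leftSet B ⊆ {a | κ a ≠ .ret} := by
  refine leftSet_subset (g := A.grammar) (D := {B : RunNT A.State | B.IsInner})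
    (fun r hr hD => ?_) hB
  obtain _ | @⟨o, r, a, q⟩ | _ | @⟨o, r, a⟩ | @⟨o, q⟩ | @⟨o, r, a⟩ := A.mem_rules_grammar.1 hr
  · exact ⟨none, by simp, .inl rfl⟩
  · exact ⟨some (.read o r), by rintro _ ⟨⟩; exact hD, .inr ⟨a, by simp [a.2], _, rfl⟩⟩
  · exact absurd hD Bool.false_ne_true
  · exact ⟨some (.read o r), by rintro _ ⟨⟩; exact hD, .inr ⟨a, by simp [a.2], _, rfl⟩⟩
  · exact ⟨some (.read o q), by rintro _ ⟨⟩; exact hD, .inl rfl⟩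
  · exact ⟨some (.read o r), by rintro _ ⟨⟩; exact hD, .inr ⟨a, by simp [a.2], _, rfl⟩⟩

theorem rightSet_grammar {B : RunNT A.State} (hB : B.IsRead) :
    A.grammar.rightSet B ⊆ {a | κ a ≠ .call} := by
  refine rightSet_subset (g := A.grammar) (D := {B : RunNT A.State | B.IsRead})
    (fun r hr hD => ?_) hB
  refine ⟨none, by simp, ?_⟩
  obtain _ | @⟨o, r, a⟩ | @⟨r, a⟩ | @⟨o, r, a, s, Z, t, b⟩ | _ | _ := A.mem_rules_grammar.1 hr
  · exact .inl rfl
  · exact .inr ⟨a, by simp [a.2], _, rfl⟩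
  · exact .inr ⟨a, by simp [a.2], _, rfl⟩
  · exact .inr ⟨b, by simp [b.2], _, rfl⟩
  · exact hD.elim
  · exact hD.elim

/-- Only `matched` has two letters. -/
theorem prec_eq_grammar {a b : T} (h : A.grammar.Prec .eq a b) : κ a = .call ∧ κ b = .ret := by
  obtain ⟨r, hr, α, β, B, h⟩ := h
  have hl : formLetters r.output = formLetters α ++ a :: b :: formLetters β := formLetters_of_eq h
  have hr' : (formLetters r.output).length ≤ 1 ∨
      ∃ c d, formLetters r.output = [c, d] ∧ κ c = .call ∧ κ d = .ret := by
    obtain _ | _ | _ | @⟨o, r, c, s, Z, t, d⟩ | _ | _ := A.mem_rules_grammar.1 hr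
    case matched => exact .inr ⟨c, d, rfl, c.2, d.2⟩
    all_goals exact .inl (Nat.le_of_ble_eq_true rfl)
  generalize formLetters α = u at hl
  generalize formLetters β = v at hl
  rw [hl] at hr'
  obtain hr' | ⟨c, d, e, hcd⟩ := hr'
  · simp at hr'
    omega
  · rcases u with _ | ⟨x, _ | ⟨y, l⟩⟩ <;> simp at e
    obtain ⟨rfl, rfl, -⟩ := e
    exact hcd

theorem isVPMatrixFor_grammar : IsVPMatrixFor κ A.grammar.opm := by
  rintro a b (_ | _ | _) h
  · obtain ⟨r, hr, α, β, D, h, hb⟩ := h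
    obtain ⟨h₁, h₂⟩ := A.adjacent_of_rule hr h
    have h₃ : κ b ≠ .ret := A.leftSet_grammar h₂ hb
    revert h₃
    simp only [totalVPMatrix, h₁]
    rcases κ b <;> simp [LetterKind.rel]
  · obtain ⟨h₁, h₂⟩ := A.prec_eq_grammar h
    simp [totalVPMatrix, h₁, h₂, LetterKind.rel]
  · obtain ⟨r, hr, α, β, D, h, ha⟩ := h
    have h₁ : κ a ≠ .call := A.rightSet_grammar (A.adjacent_of_rule hr h) ha
    revert h₁
    simp only [totalVPMatrix]
    rcases κ a <;> simp [LetterKind.rel]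

theorem isFloyd_grammar : A.grammar.IsFloyd := by
  refine ⟨?_, fun a b => Set.subsingleton_singleton.anti (A.isVPMatrixFor_grammar a b)⟩
  rintro r hr ⟨α, β, B, C, h⟩
  exact A.adjacent_of_rule hr h

/-! ### The language of the grammar of a pushdown automaton -/

/-- The words that the nonterminals of the grammar are meant to generate. -/
def runWords : RunNT A.State → Language T
  | .read o q => {w | ∀ σ : List A.Stack, (o = none → σ = []) →
      A.Run (o.getD A.start, σ) w (q, σ)}
  | .tail o => {w | ∀ σ : List A.Stack, (o = none → σ = []) →
      ∃ q ∈ A.accept, ∃ σ', A.Run (o.getD A.start, σ) w (q, σ')}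

theorem language_grammar_le {w : List T} (hw : w ∈ A.grammar.language) : w ∈ A.language := by
  refine mem_val_initial (val := A.runWords) (fun r hr w hw => ?_) hw [] (fun _ => rfl)
  obtain ⟨o⟩ | @⟨o, r, a, q, h⟩ | @⟨r, a, q, h⟩ | @⟨o, r, a, s, Z, t, b, q, h, h'⟩ |
    @⟨o, q, h⟩ | @⟨o, r, a, s, Z, h⟩ := A.mem_rules_grammar.1 hr
  · obtain rfl : w = [] := hw
    exact fun σ _ => .nil _
  · obtain ⟨u, hu, _, ⟨_, rfl, rfl⟩, rfl⟩ := hw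
    exact fun σ hσ => (hu σ hσ).append (.single (.internal σ h))
  · obtain ⟨u, hu, _, ⟨_, rfl, rfl⟩, rfl⟩ := hw
    intro σ hσ
    obtain rfl := hσ rfl
    exact (hu [] hσ).append (.single (.bottom h))
  · obtain ⟨u, hu, _, ⟨_, ⟨v, hv, _, ⟨_, rfl, rfl⟩, rfl⟩, rfl⟩, rfl⟩ := hw
    exact fun σ hσ => (hu σ hσ).append
      (.cons (.call σ h) ((hv (Z :: σ) (by simp)).append (.single (.pop σ h'))))
  · obtain ⟨u, hu, _, rfl, rfl⟩ := hw
    rw [List.append_nil]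
    exact fun σ hσ => ⟨q, h, σ, hu σ hσ⟩
  · obtain ⟨u, hu, _, ⟨_, ⟨v, hv, _, rfl, rfl⟩, rfl⟩, rfl⟩ := hw
    intro σ hσ
    rw [List.append_nil]
    obtain ⟨q, hq, σ', hrun⟩ := hv (Z :: σ) (by simp)
    exact ⟨q, hq, σ', (hu σ hσ).append (.cons (.call σ h) hrun)⟩

theorem derives_grammar {B : RunNT A.State} {s t : List (Symbol T (RunNT A.State))}
    (h : A.IsRunRule ⟨B, s⟩) (h' : A.grammar.Derives s t) :
    A.grammar.Derives [nonterminal B] t :=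
  (derives_rule (A.mem_rules_grammar.2 h)).trans h'

/-- The word `w` leads to the given state and stack, as the grammar sees it. -/
inductive RunInv : A.State → List A.Stack → List T → Prop
  | bottom {q w} (h : A.grammar.Derives [nonterminal (.read none q)] (w.map terminal)) :
      RunInv q [] w
  | pushed {r a s Z q σ u v} (hu : RunInv r σ u) (h : (r, a, s, Z) ∈ A.callTrans)
      (hv : A.grammar.Derives [nonterminal (.read (some s) q)] (v.map terminal)) :
      RunInv q (Z :: σ) (u ++ a.1 :: v)

variable {A}

/-- The top level is derived from `read o r` with `o` depending on the stack; rules uniform in `o`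
can therefore be applied there without knowing the stack. -/
theorem RunInv.extend {r q : A.State} {σ : List A.Stack} {u w : List T} (h : A.RunInv r σ u)
    (hq : ∀ (o : Option A.State) (v : List T),
      A.grammar.Derives [nonterminal (.read o r)] (v.map terminal) →
      A.grammar.Derives [nonterminal (.read o q)] ((v ++ w).map terminal)) :
    A.RunInv q σ (u ++ w) := by
  cases h with
  | bottom h => exact .bottom (hq _ _ h)
  | pushed hu h hv =>
    rw [List.append_assoc, List.cons_append]
    exact .pushed hu h (hq _ _ hv)

theorem RunInv.step {x y : A.State × List A.Stack} {u : List T} {a : T}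
    (hx : A.RunInv x.1 x.2 u) (hs : A.Step x a y) : A.RunInv y.1 y.2 (u ++ [a]) := by
  cases hs with
  | call σ h =>
    exact .pushed hx h (A.derives_grammar (.nil (some _)) (Derives.refl _))
  | pop σ h =>
    cases hx with
    | @pushed r a s Z q σ u v hu h' hv =>
      rw [List.append_assoc]
      refine hu.extend fun o v' hv' => A.derives_grammar (.matched h' h) ?_
      simp only [List.map_append, List.map_cons, List.map_nil]
      exact hv'.append ((hv.append_right [terminal _]).cons (terminal _))
  | bottom h =>
    cases hx with
    | bottom hx =>
      exact .bottom (A.derives_grammar (.bottom h) (by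
        rw [List.map_append]
        exact hx.append_right [terminal _]))
  | internal σ h =>
    exact hx.extend fun o v hv =>
      A.derives_grammar (.internal h) (by
        rw [List.map_append]
        exact hv.append_right [terminal _])

/-- Symbols left on the stack are pending calls, each worth one use of `pending`. The stack is
unwound from the top, and the suffix `t` collects the levels already passed. -/
theorem RunInv.derives_tail {q : A.State} {σ : List A.Stack} {w : List T} (h : A.RunInv q σ w) :
    ∀ t : List T, (∀ (o : Option A.State) (v : List T),
      A.grammar.Derives [nonterminal (.read o q)] (v.map terminal) →
      A.grammar.Derives [nonterminal (.tail o)] ((v ++ t).map terminal)) →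
    A.grammar.Derives [nonterminal (.tail none)] ((w ++ t).map terminal) := by
  induction h with
  | bottom h => exact fun t ht => ht _ _ h
  | @pushed r a s Z q σ u v hu h hv ih =>
    intro t ht
    rw [List.append_assoc]
    refine ih _ fun o v' hv' => A.derives_grammar (.pending h) ?_
    rw [List.map_append]
    exact hv'.append ((ht _ _ hv).cons (terminal a.1))

variable (A) in
theorem language_grammar : A.grammar.language = A.language := by
  refine Set.Subset.antisymm (fun w hw => A.language_grammar_le hw) ?_
  rintro w ⟨q, hq, σ, hrun⟩
  have h₀ : A.RunInv A.start [] [] := .bottom (A.derives_grammar (.nil none) (Derives.refl _))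
  have h := hrun.induction (P := fun x u => A.RunInv x.1 x.2 u) (fun x u a y hx hs => hx.step hs)
    [] h₀
  have h' := h.derives_tail [] fun o v hv => A.derives_grammar (.last hq) (by rwa [List.append_nil])
  rwa [List.append_nil] at h'

end VPDA

/-! ### The reflexive transitive closure of a finite relation -/

namespace EdgeList

variable {α : Type*}

open Classical in
/-- Adds the edge `e` to the finite relation `U`, transitive up to the diagonal. -/
noncomputable def insert (e : α × α) (U : List (α × α)) : List (α × α) :=
  U ++ (e.1 :: U.flatMap fun p => if p.2 = e.1 then [p.1] else []).flatMap fun x =>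
    (e.2 :: U.flatMap fun p => if p.1 = e.2 then [p.2] else []).map fun y => (x, y)

/-- The transitive closure of a finite relation, up to the diagonal. -/
noncomputable def closure (E : List (α × α)) : List (α × α) :=
  E.foldr insert []

theorem mem_insert {e : α × α} {U : List (α × α)} {x y : α} :
    (x, y) ∈ insert e U ↔ (x, y) ∈ U ∨
      ((x = e.1 ∨ (x, e.1) ∈ U) ∧ (y = e.2 ∨ (e.2, y) ∈ U)) := by
  classical
  have h₁ : ∀ z, (z ∈ U.flatMap fun p => if p.2 = e.1 then [p.1] else []) ↔ (z, e.1) ∈ U := by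
    simp
  have h₂ : ∀ z, (z ∈ U.flatMap fun p => if p.1 = e.2 then [p.2] else []) ↔ (e.2, z) ∈ U := by
    simp
  simp only [insert, List.mem_append, List.mem_flatMap (b := (x, y)), List.mem_cons, h₁,
    List.mem_map, h₂, Prod.mk.injEq]
  refine or_congr_right ⟨?_, fun ⟨hx, hy⟩ => ⟨x, hx, y, hy, rfl, rfl⟩⟩
  rintro ⟨_, hx, _, hy, rfl, rfl⟩
  exact ⟨hx, hy⟩

/-- A path may be shortened so that it uses a new edge at most once: keep the part before its first
use and the part after its last one. Hence one `insert` per edge suffices. -/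
theorem reflTransGen_iff (E : List (α × α)) {x y : α} :
    Relation.ReflTransGen (fun a b => (a, b) ∈ E) x y ↔ x = y ∨ (x, y) ∈ closure E := by
  induction E generalizing x y with
  | nil =>
    constructor
    · intro h
      induction h with
      | refl => exact .inl rfl
      | tail _ h => simp at h
    · rintro (rfl | h)
      · rfl
      · simp [closure] at h
  | cons e E ih =>
    have hc : closure (e :: E) = insert e (closure E) := rfl
    rw [hc, mem_insert]
    constructor
    · intro h
      have key : Relation.ReflTransGen (fun a b => (a, b) ∈ E) x y ∨
          (Relation.ReflTransGen (fun a b => (a, b) ∈ E) x e.1 ∧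
            Relation.ReflTransGen (fun a b => (a, b) ∈ E) e.2 y) := by
        induction h with
        | refl => exact .inl .refl
        | tail _ h ih' =>
          rcases List.mem_cons.1 h with rfl | h
          -- At a repeated use of `e`, the detour since its first use is dropped.
          · rcases ih' with h₁ | ⟨h₁, -⟩ <;> exact .inr ⟨h₁, .refl⟩
          · exact ih'.imp (·.tail h) (And.imp_right (·.tail h))
      simp only [ih] at key
      grind
    · have mono : ∀ {x y}, x = y ∨ (x, y) ∈ closure E →
          Relation.ReflTransGen (fun a b => (a, b) ∈ e :: E) x y := fun h =>
        Relation.ReflTransGen.mono (fun a b hab => List.mem_cons_of_mem _ hab) _ _ (ih.2 h)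
      rintro (h | h | ⟨h₁, h₂⟩)
      · exact mono (.inl h)
      · exact mono (.inr h)
      · exact ((mono h₁).tail (b := e.1) (c := e.2) (by simp)).trans (mono (by grind))

end EdgeList

/-! ### The parser as a function of the code of a grammar. -/

namespace GrammarCode

variable {T : Type*} (c : GrammarCode T)

/-- An element of `V_N ∪ {ε}` as a coded form. -/
def optCode (x : Option ℕ) : List (T ⊕ ℕ) :=
  x.toList.map Sum.inr

/-- The code of a symbol. -/
def ofSymbol : Symbol T ℕ → T ⊕ ℕ
  | .terminal a => .inl a
  | .nonterminal A => .inr A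

/-- The pairs of forms one of which is rewritten as a whole to the other, in a positive number
of steps. -/
noncomputable def reach : List (List (T ⊕ ℕ) × List (T ⊕ ℕ)) :=
  EdgeList.closure (c.rules.map fun r => ([Sum.inr r.1], r.2))

/-- The form `t` is obtained from `s` by rewriting forms as a whole. -/
def Reach (s t : List (T ⊕ ℕ)) : Prop :=
  s = t ∨ (s, t) ∈ c.reach

/-- The elements of `V_N ∪ {ε}` that occur in a grammar. -/
def options : List (Option ℕ) :=
  none :: some c.initial ::
    c.rules.flatMap fun r => some r.1 :: r.2.flatMap (Sum.elim (fun _ => []) fun n => [some n])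

/-- The letters that occur in a grammar. -/
def letters : List T :=
  c.rules.flatMap fun r => r.2.flatMap (Sum.elim (fun a => [a]) fun _ => [])

/-- The right part with one letter. -/
def formOne (P : Option ℕ) (a : T) (E : Option ℕ) : List (T ⊕ ℕ) :=
  optCode P ++ Sum.inl a :: optCode E

/-- The right part with two letters. -/
def formTwo (P : Option ℕ) (a : T) (Q : Option ℕ) (b : T) (E : Option ℕ) : List (T ⊕ ℕ) :=
  optCode P ++ Sum.inl a :: (optCode Q ++ Sum.inl b :: optCode E)

/-- The nonterminal `x` derives a form with a letter. -/
def Visible (x : Option ℕ) : Prop :=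
  ∃ r ∈ c.rules, c.Reach (optCode x) r.2 ∧ ∃ y ∈ r.2, y.isLeft = true

/-- The relation `a ≐ b`, in a grammar whose rules have at most two letters. -/
def EqualsIn (a b : T) : Prop :=
  ∃ r ∈ c.rules, ∃ P ∈ c.options, ∃ Q ∈ c.options, ∃ E ∈ c.options, r.2 = formTwo P a Q b E

/-- The letter `a` is the row of some relation `≐` or `⋖`. -/
def IsCall (a : T) : Prop :=
  (∃ b ∈ c.letters, c.EqualsIn a b) ∨
    ∃ r ∈ c.rules, ∃ P ∈ c.options, ∃ E ∈ c.options, r.2 = formOne P a E ∧ c.Visible E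

/-- The letter `b` is the column of some relation `≐`. -/
def IsReturn (b : T) : Prop :=
  ∃ a ∈ c.letters, c.EqualsIn a b

/-- The coded form of `ContextFreeGrammar.ReducesOne`. -/
def ReducesOne (p : Option ℕ) (a : T) (p' : Option ℕ) : Prop :=
  ∃ P ∈ c.options, ∃ E ∈ c.options, c.Reach (optCode p') (formOne P a E) ∧
    c.Reach (optCode P) (optCode p) ∧ c.Reach (optCode E) []

/-- The coded form of `ContextFreeGrammar.ReducesTwo`. -/
def ReducesTwo (p : Option ℕ) (a : T) (q : Option ℕ) (b : T) (p' : Option ℕ) : Prop :=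
  ∃ P ∈ c.options, ∃ Q ∈ c.options, ∃ E ∈ c.options,
    c.Reach (optCode p') (formTwo P a Q b E) ∧ c.Reach (optCode P) (optCode p) ∧
      c.Reach (optCode Q) (optCode q) ∧ c.Reach (optCode E) []

/-- The coded form of `ContextFreeGrammar.ExpandsTo`. -/
def ExpandsTo (x p : Option ℕ) (a : T) (y : Option ℕ) : Prop :=
  ∃ P ∈ c.options, c.Reach (optCode x) (formOne P a y) ∧ c.Reach (optCode P) (optCode p)

/-- The states of the parser. -/
def states : List (ContextFreeGrammar.ParseState ℕ) :=
  -- Listed in front so that state `0` decodes to the start; it occurs again below, which is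
  -- harmless as decoding need not be injective.
  (some (some c.initial), none) ::
    (none :: c.options.map some).flatMap fun m => c.options.map fun p => (m, p)

/-- The stack symbols of the parser. -/
def stackSymbols : List (Option (ContextFreeGrammar.ParseState ℕ × T)) :=
  none :: c.states.flatMap fun q => c.letters.map fun a => some (q, a)

/-- The state with a given number. -/
def dec (n : ℕ) : ContextFreeGrammar.ParseState ℕ :=
  c.states.getD n (none, none)

/-- The stack symbol with a given number. -/
def decStack (n : ℕ) : Option (ContextFreeGrammar.ParseState ℕ × T) :=
  c.stackSymbols.getD n none

/-- The numbers of the states. -/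
def stateRange : List ℕ :=
  List.range (c.states.length + 1)

/-- The numbers of the stack symbols. -/
def stackRange : List ℕ :=
  List.range c.stackSymbols.length

/-- The final states of the parser. -/
def IsAccept (q : ℕ) : Prop :=
  ∃ x ∈ (c.dec q).1.toList, c.Reach (optCode x) (optCode (c.dec q).2)

/-- The moves of the parser on calls. -/
def IsCallTrans (t : ℕ × T × ℕ × ℕ) : Prop :=
  (c.dec t.2.2.1 = (none, none) ∧ c.decStack t.2.2.2 = some (c.dec t.1, t.2.1)) ∨
    (c.decStack t.2.2.2 = none ∧ ∃ x ∈ (c.dec t.1).1.toList, ∃ y ∈ (c.dec t.2.2.1).1.toList,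
      (c.dec t.2.2.1).2 = none ∧ c.ExpandsTo x (c.dec t.1).2 t.2.1 y)

/-- The moves of the parser on returns. -/
def IsRetTrans (t : ℕ × T × Option ℕ × ℕ) : Prop :=
  (∃ k ∈ t.2.2.1.toList, ∃ z ∈ (c.decStack k).toList, z.1.1 = (c.dec t.2.2.2).1 ∧
    c.ReducesTwo z.1.2 z.2 (c.dec t.1).2 t.2.1 (c.dec t.2.2.2).2) ∨
  (t.2.2.1 = none ∧ (c.dec t.2.2.2).1 = (c.dec t.1).1 ∧
    c.ReducesOne (c.dec t.1).2 t.2.1 (c.dec t.2.2.2).2)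

/-- The moves of the parser on internal letters. -/
def IsIntTrans (t : ℕ × T × ℕ) : Prop :=
  (c.dec t.2.2).1 = (c.dec t.1).1 ∧ c.ReducesOne (c.dec t.1).2 t.2.1 (c.dec t.2.2).2

/-- The list of all the pairs of elements of two lists. -/
def pairs {α β : Type*} (l : List α) (l' : List β) : List (α × β) :=
  l.flatMap fun a => l'.map fun b => (a, b)

@[simp]
theorem mem_pairs {α β : Type*} {l : List α} {l' : List β} {p : α × β} :
    p ∈ pairs l l' ↔ p.1 ∈ l ∧ p.2 ∈ l' := by
  rcases p with ⟨a, b⟩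
  simp [pairs]

open Classical in
/-- The description of a parser of the grammar described by `c`. -/
noncomputable def parser : VPDACode T where
  calls := c.letters.filter (c.IsCall ·)
  returns := c.letters.filter (c.IsReturn ·)
  -- This allows one number beyond the list; it decodes to the default `(none, none)`, which is a
  -- listed state anyway.
  maxState := c.states.length
  numStack := c.stackSymbols.length
  accept := c.stateRange.filter (c.IsAccept ·)
  callTrans := (pairs c.stateRange (pairs c.letters (pairs c.stateRange c.stackRange))).filter
    (c.IsCallTrans ·)
  retTrans := (pairs c.stateRange (pairs c.letters
    (pairs (none :: c.stackRange.map some) c.stateRange))).filter (c.IsRetTrans ·)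
  intTrans := (pairs c.stateRange (pairs c.letters c.stateRange)).filter (c.IsIntTrans ·)

end GrammarCode

/-! ### Computability -/

section computability

variable {α β γ : Type*} [Primcodable α] [Primcodable β] [Primcodable γ]

theorem PrimrecPred.exists_mem {f : α → List β} {p : α → β → Prop} (hf : Primrec f)
    (hp : PrimrecPred fun z : α × β => p z.1 z.2) : PrimrecPred fun x => ∃ b ∈ f x, p x b :=
  (PrimrecRel.exists_mem_list (R := fun b x => p x b) (PrimrecRel.swap hp)).comp hf .id

theorem Primrec.filter_of {f : α → List β} {p : α → β → Prop} [∀ x, DecidablePred (p x)]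
    (hf : Primrec f) (hp : PrimrecPred fun z : α × β => p z.1 z.2) :
    Primrec fun x => (f x).filter (p x ·) := by
  let : DecidableRel fun b x => p x b := fun b x => ‹∀ x, DecidablePred (p x)› x b
  exact (PrimrecRel.listFilter (R := fun b x => p x b) (PrimrecRel.swap hp)).comp hf .id

theorem Primrec.flatMap {f : α → List β} {h : α → β → List γ} (hf : Primrec f)
    (hh : Primrec fun z : α × β => h z.1 z.2) : Primrec fun x => (f x).flatMap (h x) :=
  .list_flatMap hf hh

theorem Primrec.map {f : α → List β} {h : α → β → γ} (hf : Primrec f)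
    (hh : Primrec fun z : α × β => h z.1 z.2) : Primrec fun x => (f x).map (h x) :=
  .list_map hf hh

theorem Primrec.cons {f : α → β} {h : α → List β} (hf : Primrec f) (hh : Primrec h) :
    Primrec fun x => f x :: h x :=
  Primrec.list_cons.comp hf hh

theorem Primrec.append {f h : α → List β} (hf : Primrec f) (hh : Primrec h) :
    Primrec fun x => f x ++ h x :=
  Primrec.list_append.comp hf hh

theorem PrimrecPred.eq_of {f h : α → β} (hf : Primrec f) (hh : Primrec h) :
    PrimrecPred fun x => f x = h x :=
  Primrec.eq.comp hf hh

theorem Primrec.sumElim {δ : Type*} [Primcodable δ] {s : α → β ⊕ γ} {f : α → β → δ}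
    {h : α → γ → δ} (hs : Primrec s) (hf : Primrec fun z : α × β => f z.1 z.2)
    (hh : Primrec fun z : α × γ => h z.1 z.2) : Primrec fun x => Sum.elim (f x) (h x) (s x) :=
  (Primrec.sumCasesOn hs hf hh).of_eq fun x => by cases s x <;> rfl

theorem Primrec.pairs {f : α → List β} {h : α → List γ} (hf : Primrec f) (hh : Primrec h) :
    Primrec fun x => GrammarCode.pairs (f x) (h x) :=
  .flatMap hf (.map (hh.comp .fst) (.pair (.comp .snd .fst) .snd))

theorem EdgeList.primrec_insert :
    Primrec fun z : (α × α) × List (α × α) => EdgeList.insert z.1 z.2 := by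
  have h₁ : Primrec fun z : (α × α) × List (α × α) => z.1.1 := .comp .fst .fst
  have h₂ : Primrec fun z : (α × α) × List (α × α) => z.1.2 := .comp .snd .fst
  classical
  refine .append .snd (.flatMap (.cons h₁ (.flatMap .snd (.ite (.eq_of ?_ (h₁.comp .fst)) ?_
    (.const [])))) (.map (.cons (h₂.comp .fst) (.flatMap (.comp .snd .fst)
    (.ite (.eq_of ?_ ?_) ?_ (.const [])))) ?_))
  · exact .comp .snd .snd
  · exact .cons (.comp .fst .snd) (.const [])
  · exact .comp .fst .snd
  · exact h₂.comp (.comp .fst .fst)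
  · exact .cons (.comp .snd .snd) (.const [])
  · exact .pair (.comp .snd .fst) .snd

theorem EdgeList.primrec_closure : Primrec (EdgeList.closure (α := α)) :=
  (Primrec.list_foldr (h := fun _ p => EdgeList.insert p.1 p.2) .id (.const [])
    (Primrec₂.mk (EdgeList.primrec_insert.comp .snd))).of_eq fun _ => rfl

namespace GrammarCode

variable {T : Type*} [Primcodable T]

theorem primrec_initial : Primrec (initial : GrammarCode T → ℕ) :=
  (Primrec.fst.comp (Primrec.of_equiv (e := equivProd T))).of_eq fun _ => rfl

theorem primrec_rules : Primrec (rules : GrammarCode T → List (ℕ × List (T ⊕ ℕ))) :=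
  (Primrec.snd.comp (Primrec.of_equiv (e := equivProd T))).of_eq fun _ => rfl

theorem primrec_optCode : Primrec (optCode : Option ℕ → List (T ⊕ ℕ)) :=
  .map .optionToList (.comp .sumInr .snd)

theorem primrec_reach : Primrec (reach : GrammarCode T → _) :=
  EdgeList.primrec_closure.comp (.map primrec_rules
    (.pair (.cons (.comp .sumInr (.comp .fst .snd)) (.const [])) (.comp .snd .snd)))

theorem primrec_options : Primrec (options : GrammarCode T → _) :=
  .cons (.const none) (.cons (.comp .option_some primrec_initial)
    (.flatMap primrec_rules (.cons (.comp .option_some (.comp .fst .snd))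
    (.flatMap (.comp .snd .snd) (.sumElim .snd (.const [])
      (.cons (.comp .option_some .snd) (.const [])))))))

theorem primrec_letters : Primrec (letters : GrammarCode T → _) :=
  .flatMap primrec_rules (.flatMap (.comp .snd .snd) (.sumElim .snd
    (.cons .snd (.const [])) (.const [])))

section

variable {c : α → GrammarCode T}

theorem primrec_formOne {P E : α → Option ℕ} {a : α → T} (hP : Primrec P) (ha : Primrec a)
    (hE : Primrec E) : Primrec fun z => formOne (P z) (a z) (E z) :=
  .append (primrec_optCode.comp hP) (.cons (.comp .sumInl ha) (primrec_optCode.comp hE))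

theorem primrec_formTwo {P Q E : α → Option ℕ} {a b : α → T} (hP : Primrec P) (ha : Primrec a)
    (hQ : Primrec Q) (hb : Primrec b) (hE : Primrec E) :
    Primrec fun z => formTwo (P z) (a z) (Q z) (b z) (E z) :=
  .append (primrec_optCode.comp hP) (.cons (.comp .sumInl ha)
    (.append (primrec_optCode.comp hQ) (.cons (.comp .sumInl hb) (primrec_optCode.comp hE))))

theorem primrecPred_reach {s t : α → List (T ⊕ ℕ)} (hc : Primrec c) (hs : Primrec s)
    (ht : Primrec t) : PrimrecPred fun z => (c z).Reach (s z) (t z) :=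
  .or (.eq_of hs ht) ((PrimrecPred.exists_mem (p := fun z q => q = (s z, t z))
    (primrec_reach.comp hc)
    (.eq_of .snd ((Primrec.pair hs ht).comp .fst))).of_eq fun z => by simp)

theorem primrecPred_visible {x : α → Option ℕ} (hc : Primrec c) (hx : Primrec x) :
    PrimrecPred fun z => (c z).Visible (x z) := by
  refine .exists_mem (primrec_rules.comp hc) (.and (primrecPred_reach (hc.comp .fst)
    (primrec_optCode.comp (hx.comp .fst)) (.comp .snd .snd))
    (.exists_mem (.comp .snd .snd) (.eq_of ?_ (.const true))))
  exact (Primrec.sumCasesOn .snd (Primrec₂.const true) (Primrec₂.const false)).of_eq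
    fun z => by rcases z.2 with _ | _ <;> rfl

theorem primrecPred_equalsIn {a b : α → T} (hc : Primrec c) (ha : Primrec a) (hb : Primrec b) :
    PrimrecPred fun z => (c z).EqualsIn (a z) (b z) := by
  have ho := primrec_options.comp hc
  refine .exists_mem (primrec_rules.comp hc) (.exists_mem (ho.comp .fst)
    (.exists_mem (ho.comp (.comp .fst .fst)) (.exists_mem (ho.comp (.comp .fst (.comp .fst .fst)))
    (.eq_of ?_ (primrec_formTwo ?_ (ha.comp ?_) ?_ (hb.comp ?_) .snd)))))
  · exact .comp .snd (.comp .snd (.comp .fst (.comp .fst .fst)))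
  · exact .comp .snd (.comp .fst .fst)
  · exact .comp .fst (.comp .fst (.comp .fst .fst))
  · exact .comp .snd .fst
  · exact .comp .fst (.comp .fst (.comp .fst .fst))

theorem primrecPred_isReturn {b : α → T} (hc : Primrec c) (hb : Primrec b) :
    PrimrecPred fun z => (c z).IsReturn (b z) :=
  .exists_mem (primrec_letters.comp hc) (primrecPred_equalsIn (hc.comp .fst) .snd (hb.comp .fst))

theorem primrecPred_isCall {a : α → T} (hc : Primrec c) (ha : Primrec a) :
    PrimrecPred fun z => (c z).IsCall (a z) := by
  have ho := primrec_options.comp hc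
  refine .or (.exists_mem (primrec_letters.comp hc)
    (primrecPred_equalsIn (hc.comp .fst) (ha.comp .fst) .snd))
    (.exists_mem (primrec_rules.comp hc) (.exists_mem (ho.comp .fst)
    (.exists_mem (ho.comp (.comp .fst .fst)) (.and (.eq_of ?_ (primrec_formOne ?_ (ha.comp ?_)
    .snd)) (primrecPred_visible (hc.comp ?_) .snd)))))
  · exact .comp .snd (.comp .snd (.comp .fst .fst))
  · exact .comp .snd .fst
  · exact .comp .fst (.comp .fst .fst)
  · exact .comp .fst (.comp .fst .fst)

theorem primrecPred_reducesOne {p p' : α → Option ℕ} {a : α → T} (hc : Primrec c)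
    (hp : Primrec p) (ha : Primrec a) (hp' : Primrec p') :
    PrimrecPred fun z => (c z).ReducesOne (p z) (a z) (p' z) := by
  have ho := primrec_options.comp hc
  have hf : Primrec fun z : (α × Option ℕ) × Option ℕ => z.1.1 := .comp .fst .fst
  have hP : Primrec fun z : (α × Option ℕ) × Option ℕ => z.1.2 := .comp .snd .fst
  exact .exists_mem ho (.exists_mem (ho.comp .fst) (.and
    (primrecPred_reach (hc.comp hf) (primrec_optCode.comp (hp'.comp hf))
      (primrec_formOne hP (ha.comp hf) .snd))
    (.and (primrecPred_reach (hc.comp hf) (primrec_optCode.comp hP)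
      (primrec_optCode.comp (hp.comp hf)))
      (primrecPred_reach (hc.comp hf) (primrec_optCode.comp .snd) (.const [])))))

theorem primrecPred_reducesTwo {p q p' : α → Option ℕ} {a b : α → T} (hc : Primrec c)
    (hp : Primrec p) (ha : Primrec a) (hq : Primrec q) (hb : Primrec b) (hp' : Primrec p') :
    PrimrecPred fun z => (c z).ReducesTwo (p z) (a z) (q z) (b z) (p' z) := by
  have ho := primrec_options.comp hc
  have hf : Primrec fun z : ((α × Option ℕ) × Option ℕ) × Option ℕ => z.1.1.1 :=
    .comp .fst (.comp .fst .fst)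
  have hP : Primrec fun z : ((α × Option ℕ) × Option ℕ) × Option ℕ => z.1.1.2 :=
    .comp .snd (.comp .fst .fst)
  have hQ : Primrec fun z : ((α × Option ℕ) × Option ℕ) × Option ℕ => z.1.2 := .comp .snd .fst
  exact .exists_mem ho (.exists_mem (ho.comp .fst) (.exists_mem (ho.comp (.comp .fst .fst)) (.and
    (primrecPred_reach (hc.comp hf) (primrec_optCode.comp (hp'.comp hf))
      (primrec_formTwo hP (ha.comp hf) hQ (hb.comp hf) .snd))
    (.and (primrecPred_reach (hc.comp hf) (primrec_optCode.comp hP)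
      (primrec_optCode.comp (hp.comp hf)))
    (.and (primrecPred_reach (hc.comp hf) (primrec_optCode.comp hQ)
      (primrec_optCode.comp (hq.comp hf)))
      (primrecPred_reach (hc.comp hf) (primrec_optCode.comp .snd) (.const [])))))))

theorem primrecPred_expandsTo {x p y : α → Option ℕ} {a : α → T} (hc : Primrec c)
    (hx : Primrec x) (hp : Primrec p) (ha : Primrec a) (hy : Primrec y) :
    PrimrecPred fun z => (c z).ExpandsTo (x z) (p z) (a z) (y z) :=
  .exists_mem (primrec_options.comp hc) (.and
    (primrecPred_reach (hc.comp .fst) (primrec_optCode.comp (hx.comp .fst))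
      (primrec_formOne .snd (ha.comp .fst) (hy.comp .fst)))
    (primrecPred_reach (hc.comp .fst) (primrec_optCode.comp .snd)
      (primrec_optCode.comp (hp.comp .fst))))

theorem primrec_states : Primrec (states : GrammarCode T → _) :=
  .cons (.pair (.comp .option_some (.comp .option_some primrec_initial)) (.const none))
    (.flatMap (.cons (.const none) (.map primrec_options (.comp .option_some .snd)))
      (.map (primrec_options.comp .fst) (.pair (.comp .snd .fst) .snd)))

theorem primrec_stackSymbols : Primrec (stackSymbols : GrammarCode T → _) :=
  .cons (.const none) (.flatMap primrec_states (.map (primrec_letters.comp .fst)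
    (.comp .option_some (.pair (.comp .snd .fst) .snd))))

theorem primrec_stateRange : Primrec (stateRange : GrammarCode T → _) :=
  Primrec.list_range.comp (Primrec.succ.comp (Primrec.list_length.comp primrec_states))

theorem primrec_stackRange : Primrec (stackRange : GrammarCode T → _) :=
  Primrec.list_range.comp (Primrec.list_length.comp primrec_stackSymbols)

theorem primrec_dec {n : α → ℕ} (hc : Primrec c) (hn : Primrec n) :
    Primrec fun z => (c z).dec (n z) :=
  (Primrec.list_getD _).comp (primrec_states.comp hc) hn

theorem primrec_decStack {n : α → ℕ} (hc : Primrec c) (hn : Primrec n) :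
    Primrec fun z => (c z).decStack (n z) :=
  (Primrec.list_getD _).comp (primrec_stackSymbols.comp hc) hn

end

theorem primrecPred_isAccept :
    PrimrecPred fun z : GrammarCode T × ℕ => z.1.IsAccept z.2 := by
  have hd := primrec_dec (T := T) .fst .snd
  exact .exists_mem (.comp .optionToList (.comp .fst hd)) (primrecPred_reach (.comp .fst .fst)
    (primrec_optCode.comp .snd) (primrec_optCode.comp (.comp .snd (hd.comp .fst))))

theorem primrecPred_isCallTrans :
    PrimrecPred fun z : GrammarCode T × ℕ × T × ℕ × ℕ => z.1.IsCallTrans z.2 := by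
  have hi : Primrec fun z : GrammarCode T × ℕ × T × ℕ × ℕ => z.1.dec z.2.1 :=
    primrec_dec .fst (.comp .fst .snd)
  have ha : Primrec fun z : GrammarCode T × ℕ × T × ℕ × ℕ => z.2.2.1 :=
    .comp .fst (.comp .snd .snd)
  have hj : Primrec fun z : GrammarCode T × ℕ × T × ℕ × ℕ => z.1.dec z.2.2.2.1 :=
    primrec_dec .fst (.comp .fst (.comp .snd (.comp .snd .snd)))
  have hk : Primrec fun z : GrammarCode T × ℕ × T × ℕ × ℕ => z.1.decStack z.2.2.2.2 :=
    primrec_decStack .fst (.comp .snd (.comp .snd (.comp .snd .snd)))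
  refine .or (.and (.eq_of hj (.const _)) (.eq_of hk (.comp .option_some (.pair hi ha))))
    (.and (.eq_of hk (.const _)) (.exists_mem (.comp .optionToList (.comp .fst hi))
    (.exists_mem (.comp .optionToList (.comp .fst (hj.comp .fst))) (.and
    (.eq_of (.comp .snd (hj.comp (.comp .fst .fst))) (.const _))
    (primrecPred_expandsTo (.comp .fst (.comp .fst .fst)) (.comp .snd .fst)
      (.comp .snd (hi.comp (.comp .fst .fst))) (ha.comp (.comp .fst .fst)) .snd)))))

theorem primrecPred_isRetTrans :
    PrimrecPred fun z : GrammarCode T × ℕ × T × Option ℕ × ℕ => z.1.IsRetTrans z.2 := by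
  have hi : Primrec fun z : GrammarCode T × ℕ × T × Option ℕ × ℕ => z.1.dec z.2.1 :=
    primrec_dec .fst (.comp .fst .snd)
  have ha : Primrec fun z : GrammarCode T × ℕ × T × Option ℕ × ℕ => z.2.2.1 :=
    .comp .fst (.comp .snd .snd)
  have hk : Primrec fun z : GrammarCode T × ℕ × T × Option ℕ × ℕ => z.2.2.2.1 :=
    .comp .fst (.comp .snd (.comp .snd .snd))
  have hj : Primrec fun z : GrammarCode T × ℕ × T × Option ℕ × ℕ => z.1.dec z.2.2.2.2 :=
    primrec_dec .fst (.comp .snd (.comp .snd (.comp .snd .snd)))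
  refine .or (.exists_mem (.comp .optionToList hk) (.exists_mem (.comp .optionToList
    (primrec_decStack (.comp .fst .fst) .snd)) (.and
    (.eq_of (.comp .fst (.comp .fst .snd)) (.comp .fst (hj.comp (.comp .fst .fst))))
    (primrecPred_reducesTwo (.comp .fst (.comp .fst .fst)) (.comp .snd (.comp .fst .snd))
      (.comp .snd .snd) (.comp .snd (hi.comp (.comp .fst .fst))) (ha.comp (.comp .fst .fst))
      (.comp .snd (hj.comp (.comp .fst .fst)))))))
    (.and (.eq_of hk (.const _)) (.and (.eq_of (.comp .fst hj) (.comp .fst hi))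
    (primrecPred_reducesOne .fst (.comp .snd hi) ha (.comp .snd hj))))

theorem primrecPred_isIntTrans :
    PrimrecPred fun z : GrammarCode T × ℕ × T × ℕ => z.1.IsIntTrans z.2 := by
  have hi : Primrec fun z : GrammarCode T × ℕ × T × ℕ => z.1.dec z.2.1 :=
    primrec_dec .fst (.comp .fst .snd)
  have ha : Primrec fun z : GrammarCode T × ℕ × T × ℕ => z.2.2.1 := .comp .fst (.comp .snd .snd)
  have hj : Primrec fun z : GrammarCode T × ℕ × T × ℕ => z.1.dec z.2.2.2 :=
    primrec_dec .fst (.comp .snd (.comp .snd .snd))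
  exact .and (.eq_of (.comp .fst hj) (.comp .fst hi))
    (primrecPred_reducesOne .fst (.comp .snd hi) ha (.comp .snd hj))

/-- Apart from two lengths, the components are filtered finite lists, and the filters quantify only
over lists computed from the code. -/
theorem primrec_parser : Primrec (parser : GrammarCode T → VPDACode T) := by
  have hst := primrec_stateRange (T := T)
  have hl := primrec_letters (T := T)
  have hs := primrec_stackRange (T := T)
  classical
  refine (Primrec.of_equiv_iff (VPDACode.equivProd T)).1 ?_
  refine .pair (.filter_of hl (primrecPred_isCall .fst .snd))
    (.pair (.filter_of hl (primrecPred_isReturn .fst .snd))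
    (.pair (Primrec.list_length.comp primrec_states)
    (.pair (Primrec.list_length.comp primrec_stackSymbols)
    (.pair (.filter_of hst primrecPred_isAccept)
    (.pair (.filter_of (.pairs hst (.pairs hl (.pairs hst hs))) primrecPred_isCallTrans)
    (.pair (.filter_of (.pairs hst (.pairs hl (.pairs (.cons (.const none)
      (.map hs (.comp .option_some .snd))) hst))) primrecPred_isRetTrans)
    (.filter_of (.pairs hst (.pairs hl hst)) primrecPred_isIntTrans)))))))

end GrammarCode

end computability

/-! ### Correctness of the coded parser. -/

namespace GrammarCode

open ContextFreeGrammar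

variable {T : Type*} (c : GrammarCode T)

/-- The symbol with a given code. -/
def toSymbol : T ⊕ ℕ → Symbol T ℕ :=
  Sum.elim Symbol.terminal Symbol.nonterminal

@[simp]
theorem toSymbol_ofSymbol (x : Symbol T ℕ) : toSymbol (ofSymbol x) = x := by
  cases x <;> rfl

@[simp]
theorem ofSymbol_toSymbol (x : T ⊕ ℕ) : ofSymbol (toSymbol x) = x := by
  cases x <;> rfl

@[simp]
theorem map_toSymbol_map_ofSymbol (s : List (Symbol T ℕ)) :
    (s.map ofSymbol).map toSymbol = s := by
  rw [List.map_map]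
  exact List.map_id'' toSymbol_ofSymbol s

@[simp]
theorem map_ofSymbol_map_toSymbol (s : List (T ⊕ ℕ)) : (s.map toSymbol).map ofSymbol = s := by
  rw [List.map_map]
  exact List.map_id'' ofSymbol_toSymbol s

theorem mem_rules_toGrammar {r : ContextFreeRule T ℕ} :
    r ∈ c.toGrammar.rules ↔ (r.input, r.output.map ofSymbol) ∈ c.rules := by
  have h : r ∈ c.toGrammar.rules ↔ ∃ q ∈ c.rules,
      (⟨q.1, q.2.map toSymbol⟩ : ContextFreeRule T ℕ) = r := by
    classical exact List.mem_toFinset.trans List.mem_map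
  rw [h]
  constructor
  · rintro ⟨q, hq, rfl⟩
    rwa [map_ofSymbol_map_toSymbol]
  · intro hr
    exact ⟨_, hr, by rw [map_toSymbol_map_ofSymbol]⟩

theorem exists_rule {q : ℕ × List (T ⊕ ℕ)} (hq : q ∈ c.rules) :
    (⟨q.1, q.2.map toSymbol⟩ : ContextFreeRule T ℕ) ∈ c.toGrammar.rules :=
  (c.mem_rules_toGrammar).2 (by rwa [map_ofSymbol_map_toSymbol])

@[simp]
theorem map_ofSymbol_optNT (x : Option ℕ) : (optNT x).map ofSymbol = optCode (T := T) x := by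
  cases x <;> rfl

@[simp]
theorem map_toSymbol_optCode (x : Option ℕ) : (optCode x).map toSymbol = optNT (T := T) x := by
  cases x <;> rfl

theorem map_ofSymbol_formOne (P : Option ℕ) (a : T) (E : Option ℕ) :
    (optNT P ++ Symbol.terminal a :: optNT E).map ofSymbol = formOne P a E := by
  simp [formOne, ofSymbol]

theorem map_ofSymbol_formTwo (P : Option ℕ) (a : T) (Q : Option ℕ) (b : T) (E : Option ℕ) :
    (optNT P ++ Symbol.terminal a :: (optNT Q ++ Symbol.terminal b :: optNT E)).map ofSymbol =
      formTwo P a Q b E := by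
  simp [formTwo, ofSymbol]

theorem map_toSymbol_eq {s : List (T ⊕ ℕ)} {t : List (Symbol T ℕ)} (h : s = t.map ofSymbol) :
    s.map toSymbol = t := by
  rw [h, map_toSymbol_map_ofSymbol]

/-! ### Rewriting forms as a whole -/

theorem reach_iff {s t : List (T ⊕ ℕ)} : c.Reach s t ↔ Relation.ReflTransGen
    (fun a b => (a, b) ∈ c.rules.map fun r => ([Sum.inr r.1], r.2)) s t :=
  (EdgeList.reflTransGen_iff _).symm

theorem Reach.trans {c : GrammarCode T} {s t u : List (T ⊕ ℕ)} (h : c.Reach s t)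
    (h' : c.Reach t u) : c.Reach s u :=
  c.reach_iff.2 ((c.reach_iff.1 h).trans (c.reach_iff.1 h'))

theorem reach_rule {r : ℕ × List (T ⊕ ℕ)} (hr : r ∈ c.rules) : c.Reach [Sum.inr r.1] r.2 :=
  c.reach_iff.2 (.single (List.mem_map.2 ⟨r, hr, rfl⟩))

theorem Reach.derives {c : GrammarCode T} {s t : List (T ⊕ ℕ)} (h : c.Reach s t) :
    c.toGrammar.Derives (s.map toSymbol) (t.map toSymbol) := by
  induction c.reach_iff.1 h with
  | refl => exact Derives.refl _
  | tail h₁ h₂ ih =>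
    obtain ⟨r, hr, e⟩ := List.mem_map.1 h₂
    obtain ⟨rfl, rfl⟩ := Prod.mk.inj e
    exact (ih (c.reach_iff.2 h₁)).trans (derives_rule (c.exists_rule hr))

/-! ### The VP alphabet -/

theorem mem_options {x : Option ℕ} : x ∈ c.options ↔ x = none ∨ x = some c.initial ∨
    ∃ r ∈ c.rules, x = some r.1 ∨ ∃ n, Sum.inr n ∈ r.2 ∧ x = some n := by
  simp [options]

theorem mem_letters {a : T} : a ∈ c.letters ↔ c.toGrammar.Occurs a := by
  have h : a ∈ c.letters ↔ ∃ r ∈ c.rules, Sum.inl a ∈ r.2 := by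
    simp [letters]
  rw [h]
  constructor
  · rintro ⟨r, hr, ha⟩
    exact ⟨_, c.exists_rule hr, List.mem_map.2 ⟨_, ha, rfl⟩⟩
  · rintro ⟨r, hr, ha⟩
    exact ⟨_, c.mem_rules_toGrammar.1 hr, List.mem_map.2 ⟨_, ha, rfl⟩⟩

theorem mem_options_of_optNT {r : ContextFreeRule T ℕ} (hr : r ∈ c.toGrammar.rules)
    {B : Option ℕ} (hB : optNT B ⊆ r.output) : B ∈ c.options := by
  rw [mem_options]
  cases B with
  | none => exact .inl rfl
  | some A =>
    exact .inr (.inr ⟨_, c.mem_rules_toGrammar.1 hr, .inr ⟨A, List.mem_map.2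
      ⟨Symbol.nonterminal A, hB (by simp), rfl⟩, rfl⟩⟩)

/-- A rule of an invisible nonterminal has no letter, so its right part is empty or one nonterminal,
again invisible. Thus invisible nonterminals have left sets contained in `∅`. -/
theorem visible_of_leftSet {κ : T → LetterKind} (hg : c.toGrammar.IsOperator)
    (hκ : IsVPMatrixFor κ c.toGrammar.opm) {D : ℕ} {a : T} (ha : a ∈ c.toGrammar.leftSet D) :
    c.Visible (some D) := by
  by_contra hD
  refine Set.notMem_empty a (leftSet_subset (g := c.toGrammar)
    (D := {B : ℕ | ¬ c.Visible (some B)}) (fun r hr hB => ?_) hD ha)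
  have hvis : ∀ b, Symbol.terminal b ∉ r.output := by
    intro b hb
    exact hB ⟨_, c.mem_rules_toGrammar.1 hr, c.reach_rule (c.mem_rules_toGrammar.1 hr), _,
      List.mem_map.2 ⟨_, hb, rfl⟩, rfl⟩
  obtain ⟨B, h⟩ | ⟨P, b, E, h⟩ | ⟨P, b, Q, b', E, h⟩ := rule_shape hg hκ hr
  · refine ⟨B, ?_, .inl h⟩
    rintro A rfl ⟨r', hr', h₁, h₂⟩
    refine hB ⟨r', hr', (c.reach_rule (c.mem_rules_toGrammar.1 hr)).trans ?_, h₂⟩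
    rw [h]
    exact h₁
  · exact absurd (by simp [h]) (hvis b)
  · exact absurd (by simp [h]) (hvis b)

theorem exists_mem_leftSet {D : ℕ} (hg : c.toGrammar.IsOperator) (h : c.Visible (some D)) :
    ∃ a, a ∈ c.toGrammar.leftSet D := by
  obtain ⟨r, hr, h₁, y, hy, hl⟩ := h
  obtain ⟨a, rfl⟩ := Sum.isLeft_iff.1 hl
  have hd : c.toGrammar.Derives [Symbol.nonterminal D] (r.2.map toSymbol) := h₁.derives
  obtain ⟨B, h' | ⟨b, t, h', -⟩⟩ := OperatorForm.eq_optNT_or (hg _ (c.exists_rule hr))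
  · have : toSymbol (Sum.inl a) ∈ r.2.map toSymbol := List.mem_map.2 ⟨_, hy, rfl⟩
    rw [show r.2.map toSymbol = optNT B from h'] at this
    have h := formLetters_optNT (T := T) B
    cases List.filterMap_eq_nil_iff.1 h _ this
  · exact ⟨b, B, t, by rw [← h']; exact hd⟩

/-- As right parts have at most two letters, one that witnesses `≐` is a `formTwo` as a whole, and
the search is finite. -/
theorem equalsIn_iff {κ : T → LetterKind} (hg : c.toGrammar.IsOperator)
    (hκ : IsVPMatrixFor κ c.toGrammar.opm) {a b : T} :
    c.EqualsIn a b ↔ c.toGrammar.Prec .eq a b := by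
  constructor
  · rintro ⟨r, hr, P, -, Q, -, E, -, h⟩
    refine ⟨_, c.exists_rule hr, optNT P, optNT E, Q, map_toSymbol_eq ?_⟩
    exact h.trans (map_ofSymbol_formTwo P a Q b E).symm
  · rintro ⟨r, hr, α, β, B, h⟩
    have hl := formLetters_of_eq h
    generalize formLetters α = u at hl
    generalize formLetters β = v at hl
    obtain ⟨P, e⟩ | ⟨P, a', E, e⟩ | ⟨P, a', Q, b', E, e⟩ := rule_shape hg hκ hr
    · have h' : formLetters r.output = [] := by simp [e]
      simp [h'] at hl
    · have h' : formLetters r.output = [a'] := by simp [e]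
      have := congrArg List.length (hl.symm.trans h')
      simp at this
      omega
    · have h' : formLetters r.output = [a', b'] := by simp [e]
      rw [h'] at hl
      rcases u with _ | ⟨x, _ | ⟨y, l⟩⟩ <;> simp at hl
      obtain ⟨rfl, rfl, -⟩ := hl
      obtain ⟨hP, hQ, hE⟩ := e ▸ optNT_subset_formTwo P Q E a' b'
      exact ⟨_, c.mem_rules_toGrammar.1 hr, P, c.mem_options_of_optNT hr hP, Q,
        c.mem_options_of_optNT hr hQ, E, c.mem_options_of_optNT hr hE,
        (congrArg (List.map ofSymbol) e).trans (map_ofSymbol_formTwo ..)⟩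

theorem occurs_of_prec_eq {a b : T} (h : c.toGrammar.Prec .eq a b) :
    a ∈ c.letters ∧ b ∈ c.letters := by
  obtain ⟨r, hr, α, β, B, h⟩ := h
  constructor <;> exact c.mem_letters.2 ⟨r, hr, by simp [h]⟩

theorem kind_of_isCall {κ : T → LetterKind} (hg : c.toGrammar.IsOperator)
    (hκ : IsVPMatrixFor κ c.toGrammar.opm) {a : T} (h : c.IsCall a) : κ a = .call := by
  obtain ⟨b, -, h⟩ | ⟨r, hr, P, -, E, -, h, hE⟩ := h
  · exact (kind_of_eq hκ ((c.equalsIn_iff hg hκ).1 h)).1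
  · cases E with
    | none =>
      obtain ⟨r', -, h', y, hy, hl⟩ := hE
      -- Every rewriting starts from a single nonterminal, so the empty form reaches only itself and
      -- is not visible.
      rcases (c.reach_iff.1 h').cases_head with e | ⟨s, hs, -⟩
      · rw [← e] at hy
        cases hy
      · obtain ⟨q, -, hq⟩ := List.mem_map.1 hs
        cases (Prod.mk.inj hq).1
    | some D =>
      obtain ⟨b, hb⟩ := c.exists_mem_leftSet hg hE
      refine (kind_of_lt hκ (a := a) (b := b) ⟨_, c.exists_rule hr, optNT P, [], D, ?_, hb⟩).1
      refine map_toSymbol_eq ?_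
      exact h.trans (map_ofSymbol_formOne P a (some D)).symm

theorem isCall_of_prec_lt {κ : T → LetterKind} (hg : c.toGrammar.IsOperator)
    (hκ : IsVPMatrixFor κ c.toGrammar.opm) {a b : T} (h : c.toGrammar.Prec .lt a b) :
    a ∈ c.letters ∧ c.IsCall a := by
  have hka := (kind_of_lt hκ h).1
  obtain ⟨r, hr, α, β, D, h, hb⟩ := h
  refine ⟨c.mem_letters.2 ⟨r, hr, by simp [h]⟩, ?_⟩
  obtain ⟨P, e⟩ | ⟨P, a', E, e⟩ | ⟨P, a', Q, b', E, e⟩ := rule_shape hg hκ hr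
  · have hl : formLetters r.output = [] := by simp [e]
    simp [h] at hl
  · obtain ⟨hP, hE⟩ := e ▸ optNT_subset_formOne P E a'
    obtain ⟨rfl, rfl⟩ := eq_some_of_formOne (e.symm.trans h)
    exact .inr ⟨_, c.mem_rules_toGrammar.1 hr, P, c.mem_options_of_optNT hr hP, some D,
      c.mem_options_of_optNT hr hE, (congrArg (List.map ofSymbol) e).trans
      (map_ofSymbol_formOne ..), c.visible_of_leftSet hg hκ hb⟩
  · have hab : c.toGrammar.Prec .eq a' b' := ⟨r, hr, optNT P, optNT E, Q, e⟩
    have hl : formLetters r.output = [a', b'] := by simp [e]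
    have ha : a = a' ∨ a = b' := by
      have : a ∈ formLetters r.output := by simp [h]
      simpa [hl] using this
    rcases ha with rfl | rfl
    · exact .inl ⟨b', (c.occurs_of_prec_eq hab).2, (c.equalsIn_iff hg hκ).2 hab⟩
    · have := (kind_of_eq hκ hab).2
      simp [hka] at this

theorem kind_parser (a : T) [Decidable (a ∈ c.letters ∧ c.IsCall a)]
    [Decidable (a ∈ c.letters ∧ c.IsReturn a)] :
    c.parser.kind a = if a ∈ c.letters ∧ c.IsCall a then .call else
      if a ∈ c.letters ∧ c.IsReturn a then .ret else .internal := by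
  simp [VPDACode.kind, parser]

/-- The computed calls and returns are calls and returns in every suitable alphabet `κ`. So they do
not clash, a row of `⋗` is not a computed call, and a column of `⋖` is not a computed return. -/
theorem isVPMatrixFor_parser (hg : c.toGrammar.IsOperator) (hM : IsVPMatrix c.toGrammar.opm) :
    IsVPMatrixFor c.parser.kind c.toGrammar.opm := by
  classical
  obtain ⟨κ, hκ⟩ := hM
  have hret : ∀ b, c.IsReturn b → κ b = .ret := by
    rintro b ⟨a, -, h⟩
    exact (kind_of_eq hκ ((c.equalsIn_iff hg hκ).1 h)).2
  rintro a b (_ | _ | _) h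
  · obtain ⟨hla, ha⟩ := c.isCall_of_prec_lt hg hκ h
    have hb : ¬ c.IsReturn b := fun h' => (kind_of_lt hκ h).2 (hret b h')
    simp only [totalVPMatrix, kind_parser, hla, ha, hb, and_self, and_false, if_true, if_false]
    split_ifs <;> rfl
  · obtain ⟨hla, hlb⟩ := c.occurs_of_prec_eq h
    have hab := (c.equalsIn_iff hg hκ).2 h
    have ha : c.IsCall a := .inl ⟨b, hlb, hab⟩
    have hb : c.IsReturn b := ⟨a, hla, hab⟩
    have hb' : ¬ c.IsCall b := fun h' => by simpa [hret b hb] using c.kind_of_isCall hg hκ h'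
    simp [totalVPMatrix, kind_parser, hla, ha, hlb, hb, hb', LetterKind.rel]
  · have ha : ¬ c.IsCall a := fun h' => kind_of_gt hκ h (c.kind_of_isCall hg hκ h')
    simp only [totalVPMatrix, kind_parser, ha, and_false, if_false]
    split_ifs <;> rfl

/-! ### The parser -/

theorem none_mem_options : none ∈ c.options := by
  simp [options]

theorem none_mem_stackSymbols : none ∈ c.stackSymbols := by
  simp [stackSymbols]

theorem some_mem_stackSymbols {q : ParseState ℕ} {a : T} (hq : q ∈ c.states)
    (ha : a ∈ c.letters) : some (q, a) ∈ c.stackSymbols := by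
  simp [stackSymbols, hq, ha]

theorem derives_of_reach {x : Option ℕ} {s : List (Symbol T ℕ)}
    (h : c.Reach (optCode x) (s.map ofSymbol)) : c.toGrammar.Derives (optNT x) s :=
  Eq.mp (congrArg₂ c.toGrammar.Derives (map_toSymbol_optCode x) (map_toSymbol_map_ofSymbol s))
    h.derives

theorem exists_dec {q : ParseState ℕ} (hq : q ∈ c.states) :
    ∃ i : Fin (c.states.length + 1), c.dec i = q := by
  obtain ⟨i, hi, rfl⟩ := List.getElem_of_mem hq
  exact ⟨⟨i, by omega⟩, by simp [dec, hi]⟩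

theorem exists_decStack {z : Option (ParseState ℕ × T)} (hz : z ∈ c.stackSymbols) :
    ∃ i : Fin c.stackSymbols.length, c.decStack i = z := by
  obtain ⟨i, hi, rfl⟩ := List.getElem_of_mem hz
  exact ⟨⟨i, hi⟩, by simp [decStack, hi]⟩

theorem mem_states {q : ParseState ℕ} :
    q ∈ c.states ↔ (∀ x ∈ q.1, x ∈ c.options) ∧ q.2 ∈ c.options := by
  obtain ⟨_ | x, p⟩ := q
  · simp [states]
  · have h₁ : none ∈ c.options := by simp [options]
    have h₂ : some c.initial ∈ c.options := by simp [options]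
    simp [states]
    grind

theorem dec_mem_states (n : ℕ) : c.dec n ∈ c.states := by
  have h : ((none, none) : ParseState ℕ) ∈ c.states := by simp [mem_states, options]
  by_cases hn : n < c.states.length
  · simp [dec, hn]
  · simpa [dec, hn] using h

theorem reducesOne_iff {p p' : Option ℕ} {a : T} : c.ReducesOne p a p' ↔
    ContextFreeGrammar.ReducesOne (g := c.toGrammar) {x | x ∈ c.options}
      (fun x s => c.Reach (optCode x) (s.map ofSymbol)) p a p' := by
  refine exists_congr fun P => and_congr_right fun _ => exists_congr fun E =>
    and_congr_right fun _ => ?_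
  rw [← map_ofSymbol_formOne, ← map_ofSymbol_optNT p]
  rfl

theorem reducesTwo_iff {p q p' : Option ℕ} {a b : T} : c.ReducesTwo p a q b p' ↔
    ContextFreeGrammar.ReducesTwo (g := c.toGrammar) {x | x ∈ c.options}
      (fun x s => c.Reach (optCode x) (s.map ofSymbol)) p a q b p' := by
  refine exists_congr fun P => and_congr_right fun _ => exists_congr fun Q =>
    and_congr_right fun _ => exists_congr fun E => and_congr_right fun _ => ?_
  rw [← map_ofSymbol_formTwo, ← map_ofSymbol_optNT p, ← map_ofSymbol_optNT q]
  rfl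

theorem expandsTo_iff {x p y : Option ℕ} {a : T} : c.ExpandsTo x p a y ↔
    ContextFreeGrammar.ExpandsTo (g := c.toGrammar) {x | x ∈ c.options}
      (fun x s => c.Reach (optCode x) (s.map ofSymbol)) x p a y := by
  refine exists_congr fun P => and_congr_right fun _ => ?_
  rw [← map_ofSymbol_formOne, ← map_ofSymbol_optNT p]
  rfl

theorem mem_accept_parser {q : ℕ} :
    q ∈ c.parser.accept ↔ q < c.states.length + 1 ∧ c.IsAccept q := by
  simp [parser, stateRange]

theorem mem_callTrans_parser {t : ℕ × T × ℕ × ℕ} : t ∈ c.parser.callTrans ↔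
    (t.1 < c.states.length + 1 ∧ t.2.2.1 < c.states.length + 1 ∧
      t.2.2.2 < c.stackSymbols.length) ∧ c.toGrammar.Occurs t.2.1 ∧ c.IsCallTrans t := by
  simp [parser, stateRange, stackRange, mem_letters]
  tauto

theorem mem_retTrans_parser {t : ℕ × T × Option ℕ × ℕ} : t ∈ c.parser.retTrans ↔
    (t.1 < c.states.length + 1 ∧ (∀ k ∈ t.2.2.1, k < c.stackSymbols.length) ∧
      t.2.2.2 < c.states.length + 1) ∧ c.toGrammar.Occurs t.2.1 ∧ c.IsRetTrans t := by
  obtain ⟨i, b, _ | k, j⟩ := t <;> simp [parser, stateRange, stackRange, mem_letters] <;> tauto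

theorem mem_intTrans_parser {t : ℕ × T × ℕ} : t ∈ c.parser.intTrans ↔
    (t.1 < c.states.length + 1 ∧ t.2.2 < c.states.length + 1) ∧ c.toGrammar.Occurs t.2.1 ∧
      c.IsIntTrans t := by
  simp [parser, stateRange, mem_letters]
  tauto

theorem isAccept_iff {q : ℕ} : c.IsAccept q ↔
    ∃ x, (c.dec q).1 = some x ∧ c.Reach (optCode x) ((optNT (c.dec q).2).map ofSymbol) := by
  simp [IsAccept]

theorem isCallTrans_iff {i j k : ℕ} {a : T} : c.IsCallTrans (i, a, j, k) ↔
    (c.dec j = (none, none) ∧ c.decStack k = some (c.dec i, a)) ∨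
      (c.decStack k = none ∧ ∃ x y, (c.dec i).1 = some x ∧ c.dec j = (some y, none) ∧
        ContextFreeGrammar.ExpandsTo (g := c.toGrammar) {x | x ∈ c.options}
          (fun x s => c.Reach (optCode x) (s.map ofSymbol)) x (c.dec i).2 a y) := by
  refine or_congr_right (and_congr_right fun _ => ?_)
  simp only [Option.mem_toList, ← expandsTo_iff]
  constructor
  · rintro ⟨x, hx, y, hy, hn, h⟩
    exact ⟨x, y, hx, Prod.ext hy hn, h⟩
  · rintro ⟨x, y, hx, hy, h⟩
    exact ⟨x, hx, y, by rw [hy], by rw [hy], h⟩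

theorem isRetTrans_some_iff {i j k : ℕ} {b : T} : c.IsRetTrans (i, b, some k, j) ↔
    ∃ p a, c.decStack k = some (((c.dec j).1, p), a) ∧
      ContextFreeGrammar.ReducesTwo (g := c.toGrammar) {x | x ∈ c.options}
        (fun x s => c.Reach (optCode x) (s.map ofSymbol)) p a (c.dec i).2 b (c.dec j).2 := by
  simp only [IsRetTrans, Option.mem_toList, Option.some.injEq, reduceCtorEq,
    false_and, or_false, exists_eq_left', ← reducesTwo_iff]
  constructor
  · rintro ⟨⟨⟨m, p⟩, a⟩, hz, hm, h⟩
    exact ⟨p, a, by rw [hz, ← hm], h⟩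
  · rintro ⟨p, a, hz, h⟩
    exact ⟨_, hz, rfl, h⟩

theorem isRetTrans_none_iff {i j : ℕ} {b : T} : c.IsRetTrans (i, b, none, j) ↔
    (c.dec j).1 = (c.dec i).1 ∧
      ContextFreeGrammar.ReducesOne (g := c.toGrammar) {x | x ∈ c.options}
        (fun x s => c.Reach (optCode x) (s.map ofSymbol)) (c.dec i).2 b (c.dec j).2 := by
  simp [IsRetTrans, reducesOne_iff]

theorem isIntTrans_iff {i j : ℕ} {a : T} : c.IsIntTrans (i, a, j) ↔
    (c.dec j).1 = (c.dec i).1 ∧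
      ContextFreeGrammar.ReducesOne (g := c.toGrammar) {x | x ∈ c.options}
        (fun x s => c.Reach (optCode x) (s.map ofSymbol)) (c.dec i).2 a (c.dec j).2 :=
  and_congr_right fun _ => c.reducesOne_iff

/-- Rewriting forms as a whole is in general smaller than derivability, but it contains the rules
and composes along single nonterminals, which is all that `IsParser` asks for besides soundness. -/
theorem isParser_parser : IsParser c.toGrammar c.parser.toVPDA {x | x ∈ c.options}
    (fun x s => c.Reach (optCode x) (s.map ofSymbol))
    (fun q : Fin (c.states.length + 1) => c.dec q)
    (fun Z : Fin c.stackSymbols.length => c.decStack Z) where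
  sound _ _ h := c.derives_of_reach h
  refl x := .inl (map_ofSymbol_optNT x).symm
  trans x D s h h' := Reach.trans h h'
  rule r hr := c.reach_rule (c.mem_rules_toGrammar.1 hr)
  none_mem := c.none_mem_options
  initial_mem := c.mem_options.2 (.inr (.inl rfl))
  input_mem r hr := c.mem_options.2 (.inr (.inr ⟨_, c.mem_rules_toGrammar.1 hr, .inl rfl⟩))
  output_mem r hr D hD := c.mem_options_of_optNT hr (B := some D) fun y hy => by
    rw [List.mem_singleton.1 hy]
    exact hD
  dec_start := rfl
  accept_iff q := c.mem_accept_parser.trans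
    ((and_iff_right (Fin.is_lt q)).trans c.isAccept_iff)
  call_iff q a q' Z := c.mem_callTrans_parser.trans
    ((and_iff_right ⟨Fin.is_lt q, Fin.is_lt q', Fin.is_lt Z⟩).trans
      (and_congr_right fun _ => c.isCallTrans_iff))
  pop_iff q b q' Z := c.mem_retTrans_parser.trans
    ((and_iff_right ⟨Fin.is_lt q, by rintro _ ⟨⟩; exact Fin.is_lt Z, Fin.is_lt q'⟩).trans
      (and_congr_right fun _ => c.isRetTrans_some_iff))
  bottom_iff q b q' := c.mem_retTrans_parser.trans
    ((and_iff_right ⟨Fin.is_lt q, by rintro _ ⟨⟩, Fin.is_lt q'⟩).trans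
      (and_congr_right fun _ => c.isRetTrans_none_iff))
  internal_iff q a q' := c.mem_intTrans_parser.trans
    ((and_iff_right ⟨Fin.is_lt q, Fin.is_lt q'⟩).trans
      (and_congr_right fun _ => c.isIntTrans_iff))
  exists_current q y hy := by
    have hq := c.mem_states.1 (c.dec_mem_states (Fin.val q))
    exact c.exists_dec (c.mem_states.2 ⟨hq.1, hy⟩)
  exists_locked := c.exists_dec (c.mem_states.2 ⟨by rintro _ ⟨⟩, c.none_mem_options⟩)
  exists_goal x hx := c.exists_dec (c.mem_states.2 ⟨by rintro _ ⟨⟩; exact hx, c.none_mem_options⟩)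
  exists_stack_none := c.exists_decStack c.none_mem_stackSymbols
  exists_stack_some q a ha := c.exists_decStack
    (c.some_mem_stackSymbols (c.dec_mem_states (Fin.val q)) (c.mem_letters.2 ha))

end GrammarCode

/-- (1) A Floyd grammar over a finite alphabet whose precedence matrix is contained in the total
VP matrix of `κ` generates the language of a VPDA over the VP alphabet `κ`.
(2) One algorithm, given any Floyd grammar whose precedence matrix is a VP matrix, outputs a VP
alphabet that witnesses this and an equivalent VPDA over it. The letters are drawn from an
arbitrary effectively coded supply `T` (for instance `ℕ`, or a finite type), of which each grammar
uses finitely many, so that the algorithm is uniform in the alphabet.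
(3) The VPDA languages over a finite alphabet are exactly the languages of Floyd grammars whose
precedence matrix is a VP matrix. -/
theorem mainTheorem2 :
    (∀ (T : Type*) [Finite T] (κ : T → LetterKind) (g : ContextFreeGrammar T),
      g.IsFloyd → IsVPMatrixFor κ g.opm → ∃ A : VPDA T κ, A.language = g.language) ∧
    (∀ (T : Type*) [Primcodable T], ∃ F : GrammarCode T → VPDACode T, Computable F ∧
      ∀ c : GrammarCode T, c.toGrammar.IsFloyd → IsVPMatrix c.toGrammar.opm →
        IsVPMatrixFor (F c).kind c.toGrammar.opm ∧
          (F c).toVPDA.language = c.toGrammar.language) ∧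
    (∀ (T : Type*) [Finite T] (L : Language T),
      IsVPDALanguage L ↔
        ∃ g : ContextFreeGrammar T, g.IsFloyd ∧ IsVPMatrix g.opm ∧ g.language = L) := by
  refine ⟨fun T _ κ g hg hκ => g.exists_vpda_language_eq hg.1 hκ, fun T _ => ?_, fun T _ L => ?_⟩
  · refine ⟨GrammarCode.parser, GrammarCode.primrec_parser.to_comp, fun c hg hM => ?_⟩
    have hκ := c.isVPMatrixFor_parser hg.1 hM
    exact ⟨hκ, c.isParser_parser.language_eq hg.1 hκ⟩
  · constructor
    · rintro ⟨κ, A, rfl⟩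
      exact ⟨A.grammar, A.isFloyd_grammar, ⟨κ, A.isVPMatrixFor_grammar⟩, A.language_grammar⟩
    · rintro ⟨g, hg, ⟨κ, hκ⟩, rfl⟩
      obtain ⟨A, hA⟩ := g.exists_vpda_language_eq hg.1 hκ
      exact ⟨κ, A, hA⟩
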